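/- **Theorem 2 (Lower bound).** Let $\mathcal T\subset\mathbb R$ be compact, let $K$ be a continuous reproducing kernel on $\mathcal T\times\mathcal T$ with RKHS $\mathcal H(K)$ and norm $\|\cdot\|_K$. Task $l=0$ is the target and the tasks $l\in\mathcal S=\{1,\dots,m\}$ are the sources ($m\ge 0$). From task $l$ one observes $n_l$ pairs $$Y_i^{(l)}=\langle X_i^{(l)},\beta^{(l)}\rangle_{L^2(\mathcal T)}+\epsilon_i^{(l)},\qquad \beta^{(l)}\in\mathcal H(K),$$ where the $X_i^{(l)}$ are copies of a random element $X^{(l)}$ of $L^2(\mathcal T)$ with $\mathbb E\|X^{(l)}\|^2<\infty$, $\epsilon_i^{(l)}\sim N(0,\sigma_l^2)$ with $\sigma_l^2>0$, and all covariates and errors are independent. Let $L_{C^{(l)}}$ be the covariance operator of $X^{(l)}$, $L_{T^{(l)}}=L_{K^{1/2}}L_{C^{(l)}}L_{K^{1/2}}$, and let $s_1\ge s_2\ge\cdots$ and $\phi_1,\phi_2,\dots$ be the eigenvalues and orthonormal eigenfunctions of $L_{T^{(0)}}$. Put $n_{\mathcal S}=\sum_{l\in\mathcal S}n_l$ and $\alpha_l=n_l/(n_{\mathcal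 S}+n_0)$. Assume that $s_j\asymp j^{-2r}$ for some $r>0$ (ratios bounded above and below suffice), and that one of the following holds: 1. for all $l\in\mathcal S$, $L_{T^{(l)}}$ commutes with $L_{T^{(0)}}$ and $\langle L_{T^{(l)}}\phi_j,\phi_j\rangle=O(s_j)$ as $j\to\infty$; 2. for all $l\in\mathcal S$, $I-L_{T^{(0)}}^{-1/2}L_{T^{(l)}}L_{T^{(0)}}^{-1/2}$ is a Hilbert–Schmidt operator $D_l$, that is, $L_{T^{(l)}}=L_{T^{(0)}}^{1/2}(I-D_l)L_{T^{(0)}}^{1/2}$ with $D_l$ Hilbert–Schmidt. For a fixed $h\ge0$ let $\Theta(h)$ be the set of all $\beta=(\beta^{(l)})_{0\le l\le m}$ in $\mathcal H(K)$ with $\|\beta^{(0)}-\beta^{(l)}\|_K\le h$ for all $l$. The pooled slope $\beta_{\mathcal S}=\beta_{\mathcal S}(\beta)$ is $L_{K^{1/2}}f_{\mathcal S}$, where $\big(\sum_{l=0}^m\alpha_lL_{T^{(l)}}\big)f_{\mathcal S}=\sum_{l=0}^m\alpha_lL_{T^{(l)}}f_l$ and $\beta^{(l)}=L_{K^{1/2}}f_l$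 (the solution $\beta_{\mathcal S}$ of least norm $\|\cdot\|_K$ if there are several). When it exists and is nonzero, put $\xi(h,\mathcal S)=(h/\|\beta_{\mathcal S}\|_K)^{2/(2r+1)}$. The excess risk of an estimator $\tilde\beta$, i.e. a measurable function of all the data with values in $L^2(\mathcal T)$, is $\mathcal E(\tilde\beta)=\mathbb E\big[\langle X^{(0)},\tilde\beta-\beta^{(0)}\rangle^2\mid\text{data}\big]$, with $X^{(0)}$ independent of the data. Consider a sequence of sample sizes with $n_0\to\infty$ and $n_0/n_{\mathcal S}\nrightarrow0$ (always the case if $n_{\mathcal S}=0$). Then $$\lim_{a\downarrow0}\ \liminf_{n\to\infty}\ \inf_{\tilde\beta}\ \sup_{\beta\in\Theta(h)}P_\beta\Big\{\mathcal E(\tilde\beta)\ge a\Big((n_{\mathcal S}+n_0)^{-\frac{2r}{2r+1}}+n_0^{-\frac{2r}{2r+1}}\,\xi(h,\mathcal S)\Big)\Big\}=1,$$ where the supremum is over those $\beta\in\Theta(h)$ for which $\beta_{\mathcal S}$ exists and is nonzero. Moreover, if $n_0/n_{\mathcal S}$ is bounded away from $0$, then for every fixed $R>0$ the same holds with the supremum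 restricted to the $\beta\in\Theta(h)$ with $\|\beta_{\mathcal S}\|_K=R$, so that $\xi(h,\mathcal S)=(h/R)^{2/(2r+1)}$ is a constant. -/

import Mathlib

open MeasureTheory ProbabilityTheory Filter Topology Asymptotics
open scoped NNReal ENNReal RealInnerProductSpace

noncomputable section

namespace FLR

/-! ### The space `L²(𝒯)` -/

/-- Lebesgue measure on a set `𝒯 ⊆ ℝ`. -/
def leb (𝒯 : Set ℝ) : Measure 𝒯 := (volume : Measure ℝ).comap Subtype.val

instance (𝒯 : Set ℝ) [CompactSpace 𝒯] : IsFiniteMeasure (leb 𝒯) := by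
  have hc : IsCompact 𝒯 := isCompact_iff_compactSpace.mpr inferInstance
  refine ⟨?_⟩
  rw [leb, comap_subtype_coe_apply hc.measurableSet]
  simpa using hc.measure_lt_top

/-- `L²(𝒯)`. -/
abbrev L2 (𝒯 : Set ℝ) : Type := Lp ℝ 2 (leb 𝒯)

instance (𝒯 : Set ℝ) : MeasurableSpace (L2 𝒯) := borel _

instance (𝒯 : Set ℝ) : BorelSpace (L2 𝒯) := ⟨rfl⟩

/-! ### Integral operators and square roots -/

section Operators

variable {𝒯 : Set ℝ} [CompactSpace 𝒯]

/-- The sections `Γ(s, ·)` of a continuous kernel depend continuously on `s` in `L²(𝒯)`. -/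
def sectionL2 (Γ : C(𝒯 × 𝒯, ℝ)) : C(𝒯, L2 𝒯) :=
  ⟨fun s => ContinuousMap.toLp 2 (leb 𝒯) ℝ (Γ.curry s),
    (ContinuousMap.toLp 2 (leb 𝒯) ℝ : C(𝒯, ℝ) →L[ℝ] L2 𝒯).continuous.comp Γ.curry.continuous⟩

theorem integral_kernel_eq_inner (Γ : C(𝒯 × 𝒯, ℝ)) (f : L2 𝒯) (s : 𝒯) :
    ∫ t, Γ (s, t) * f t ∂(leb 𝒯) = ⟪sectionL2 Γ s, f⟫ := by
  rw [L2.inner_def]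
  refine integral_congr_ae ?_
  filter_upwards [ContinuousMap.coeFn_toLp (p := 2) (𝕜 := ℝ) (leb 𝒯) (Γ.curry s)] with t ht
  have h : (sectionL2 Γ s : 𝒯 → ℝ) t = Γ (s, t) := ht
  simp [h, mul_comm]

/-- The function `s ↦ ∫ Γ(s, t) f(t) dt`, which is continuous. -/
def kernelIntegral (Γ : C(𝒯 × 𝒯, ℝ)) (f : L2 𝒯) : C(𝒯, ℝ) where
  toFun s := ∫ t, Γ (s, t) * f t ∂(leb 𝒯)
  continuous_toFun := by
    simp_rw [integral_kernel_eq_inner]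
    exact (sectionL2 Γ).continuous.inner continuous_const

theorem kernelIntegral_apply (Γ : C(𝒯 × 𝒯, ℝ)) (f : L2 𝒯) (s : 𝒯) :
    kernelIntegral Γ f s = ⟪sectionL2 Γ s, f⟫ :=
  integral_kernel_eq_inner Γ f s

/-- The integral operator `L_Γ f = ∫ Γ(·, t) f(t) dt` on `L²(𝒯)`. -/
def integralOp (Γ : C(𝒯 × 𝒯, ℝ)) : L2 𝒯 →L[ℝ] L2 𝒯 :=
  (ContinuousMap.toLp 2 (leb 𝒯) ℝ : C(𝒯, ℝ) →L[ℝ] L2 𝒯) ∘L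
    (LinearMap.mkContinuous (σ := RingHom.id ℝ)
      { toFun := kernelIntegral Γ
        map_add' := fun f g => by
          ext s
          simp [kernelIntegral_apply, inner_add_right]
        map_smul' := fun c f => by
          ext s
          simp [kernelIntegral_apply, inner_smul_right] }
      ‖sectionL2 Γ‖
      (fun f => by
        refine (ContinuousMap.norm_le _ (by positivity)).mpr fun s => ?_
        change ‖kernelIntegral Γ f s‖ ≤ _
        rw [kernelIntegral_apply]
        exact (norm_inner_le_norm _ _).trans
          (mul_le_mul_of_nonneg_right ((sectionL2 Γ).norm_coe_le_norm s) (norm_nonneg f))))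

open Classical in
/-- The positive square root of a positive bounded operator on a real Hilbert space (a positive
operator has exactly one positive square root). -/
def posSqrt {E : Type*} [NormedAddCommGroup E] [InnerProductSpace ℝ E] (A : E →L[ℝ] E) :
    E →L[ℝ] E :=
  if h : ∃ B : E →L[ℝ] E, B.IsPositive ∧ B ∘L B = A then h.choose else 0

/-- Hilbert--Schmidt operators. -/
def IsHilbertSchmidt {E : Type*} [NormedAddCommGroup E] [InnerProductSpace ℝ E]
    (A : E →L[ℝ] E) : Prop :=
  ∃ (w : Set E) (b : HilbertBasis w ℝ E), Summable fun i => ‖A (b i)‖ ^ 2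

/-- `(s_j, φ_j)` is the full sequence of eigenvalues of `A`, in non-increasing order and repeated
according to multiplicity, with orthonormal eigenfunctions `φ_j`; `A` vanishes on the orthogonal
complement of the `φ_j`. -/
structure IsEigenSystem (A : L2 𝒯 →L[ℝ] L2 𝒯) (s : ℕ → ℝ) (φ : ℕ → L2 𝒯) : Prop where
  orthonormal : Orthonormal ℝ φ
  antitone : Antitone s
  eigen : ∀ j, A (φ j) = s j • φ j
  complete : ∀ f, (∀ j, ⟪φ j, f⟫ = 0) → A f = 0

/-- The covariance operator `L_C` of a random element of `L²(𝒯)` with law `μ`: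
`⟪L_C f, g⟫ = Cov(⟪X, f⟫, ⟪X, g⟫)`. -/
def covOp (μ : Measure (L2 𝒯)) : L2 𝒯 →L[ℝ] L2 𝒯 :=
  InnerProductSpace.continuousLinearMapOfBilin (covarianceBilin μ)

end Operators

/-! ### The reproducing kernel Hilbert space -/

section Kernel

variable {𝒯 : Set ℝ} [CompactSpace 𝒯]
variable (H : Type*) [NormedAddCommGroup H] [InnerProductSpace ℝ H] [CompleteSpace H]
  [RKHS ℝ H 𝒯 ℝ]

/-- The reproducing kernel `K` of `H = H(K)` is continuous on `𝒯 × 𝒯`. -/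
class ContinuousKernel : Prop where
  continuous_kernel : Continuous fun p : 𝒯 × 𝒯 => RKHS.kernel H p.1 p.2 1

variable [ContinuousKernel H]

/-- The reproducing kernel of `H`, as a continuous function on `𝒯 × 𝒯`. -/
def kern : C(𝒯 × 𝒯, ℝ) := ⟨fun p => RKHS.kernel H p.1 p.2 1, ContinuousKernel.continuous_kernel⟩

/-- The operator `L_{K^{1/2}}`. -/
def sqrtK : L2 𝒯 →L[ℝ] L2 𝒯 := posSqrt (integralOp (kern H))

/-- `L_T = L_{K^{1/2}} L_C L_{K^{1/2}}`, for the covariance operator `L_C` of the law `μ`. -/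
def opT (μ : Measure (L2 𝒯)) : L2 𝒯 →L[ℝ] L2 𝒯 := sqrtK H ∘L covOp μ ∘L sqrtK H

variable {H}

set_option linter.unusedSectionVars false in
theorem continuous_coe (b : H) : Continuous (b : 𝒯 → ℝ) := by
  obtain ⟨k, hk⟩ : ∃ k : 𝒯 → 𝒯 → ℝ, ∀ x y, k x y = RKHS.kernel H x y 1 := ⟨_, fun _ _ => rfl⟩
  have hc : Continuous fun p : 𝒯 × 𝒯 => k p.1 p.2 := by
    simp_rw [hk]
    exact ContinuousKernel.continuous_kernel
  obtain ⟨g, hg⟩ : ∃ g : 𝒯 → H, ∀ x, g x = RKHS.kerFun H x (1 : ℝ) := ⟨_, fun _ => rfl⟩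
  have hin : ∀ x y : 𝒯, ⟪g x, g y⟫ = k y x := by
    intro x y
    rw [hg, hg, hk, ← RKHS.kerFun_apply, RKHS.inner_kerFun]
    simp
  have hsq : ∀ x y : 𝒯, ‖g y - g x‖ = √(k y y - 2 * k x y + k x x) := by
    intro x y
    rw [← hin, ← hin, ← hin, real_inner_self_eq_norm_sq, real_inner_self_eq_norm_sq,
      ← norm_sub_sq_real, Real.sqrt_sq (norm_nonneg _)]
  have hf : Continuous g := by
    rw [continuous_iff_continuousAt]
    intro x
    rw [ContinuousAt, tendsto_iff_norm_sub_tendsto_zero]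
    simp_rw [hsq]
    have h1 : Continuous fun y : 𝒯 => k y y := hc.comp (continuous_id.prodMk continuous_id)
    have h2 : Continuous fun y : 𝒯 => k x y := hc.comp (continuous_const.prodMk continuous_id)
    have h3 : Continuous fun y : 𝒯 => √(k y y - 2 * k x y + k x x) := by fun_prop
    have h4 := h3.tendsto x
    have h5 : k x x - 2 * k x x + k x x = 0 := by ring
    rwa [h5, Real.sqrt_zero] at h4
  have he : (b : 𝒯 → ℝ) = fun x => ⟪g x, b⟫ := by
    funext x
    rw [hg, RKHS.kerFun_inner]
    simp
  rw [he]
  exact hf.inner continuous_const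

/-- An element of `H(K)` seen in `L²(𝒯)`. -/
def emb (b : H) : L2 𝒯 := ContinuousMap.toLp 2 (leb 𝒯) ℝ ⟨b, continuous_coe b⟩

end Kernel

/-! ### The two conditions relating the source operators to the target operator

Tasks are indexed by `Fin (m + 1)`; `0` is the target and `S = {1, …, m}` are the sources. -/

section Conditions

variable {𝒯 : Set ℝ} {m : ℕ}

/-- Each source operator commutes with the target operator, and its diagonal
`⟪T⁽ˡ⁾ φ_j, φ_j⟫` is `O(s_j)`. -/
def CommuteCondition (T : Fin (m + 1) → (L2 𝒯 →L[ℝ] L2 𝒯)) (s : ℕ → ℝ) (φ : ℕ → L2 𝒯) :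
    Prop :=
  ∀ l : Fin m, Commute (T l.succ) (T 0) ∧
    (fun j => ⟪T l.succ (φ j), φ j⟫) =O[atTop] s

/-- For each source, `D = I - (T⁽⁰⁾)^{-1/2} T⁽ˡ⁾ (T⁽⁰⁾)^{-1/2}` is Hilbert--Schmidt. The identity
is written multiplied out by `(T⁽⁰⁾)^{1/2}`, the inverse root being unbounded. -/
def HSCondition (T : Fin (m + 1) → (L2 𝒯 →L[ℝ] L2 𝒯)) : Prop :=
  ∀ l : Fin m, ∃ D : L2 𝒯 →L[ℝ] L2 𝒯, IsHilbertSchmidt D ∧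
    T l.succ = posSqrt (T 0) ∘L (1 - D) ∘L posSqrt (T 0)

end Conditions

/-! ### The statistical model -/

section Model

variable {𝒯 : Set ℝ} [CompactSpace 𝒯] {m : ℕ}
variable {H : Type*} [NormedAddCommGroup H] [InnerProductSpace ℝ H] [CompleteSpace H]
  [RKHS ℝ H 𝒯 ℝ] [ContinuousKernel H]

/-- All the data: `n l` pairs `(X, Y)` from each task `l`. -/
abbrev Data (𝒯 : Set ℝ) (n : Fin (m + 1) → ℕ) : Type :=
  (l : Fin (m + 1)) → Fin (n l) → L2 𝒯 × ℝ

/-- Law of one observation `(X, Y)`, where `Y = ⟪X, β⟫ + ε`, `X` has law `μ`, and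
`ε ∼ N(0, v)` is independent of `X`. -/
def obsLaw (μ : Measure (L2 𝒯)) (v : ℝ≥0) (β : H) : Measure (L2 𝒯 × ℝ) :=
  (μ.prod (gaussianReal 0 v)).map fun p => (p.1, ⟪p.1, emb β⟫ + p.2)

/-- Law of the data: all observations of all tasks are independent. -/
def dataLaw (μ : Fin (m + 1) → Measure (L2 𝒯)) (v : Fin (m + 1) → ℝ≥0)
    (n : Fin (m + 1) → ℕ) (β : Fin (m + 1) → H) : Measure (Data 𝒯 n) :=
  Measure.pi fun l => Measure.pi fun _ : Fin (n l) => obsLaw (μ l) (v l) (β l)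

/-- The excess risk of the slope `g`, when the target has covariate law `μ₀` and slope `β₀`. -/
def excessRisk (μ₀ : Measure (L2 𝒯)) (g : L2 𝒯) (β₀ : H) : ℝ :=
  ∫ x, (⟪x, g⟫ - ⟪x, emb β₀⟫) ^ 2 ∂μ₀

/-- The total source sample size `n_S`. -/
def nS (n : Fin (m + 1) → ℕ) : ℕ := ∑ l : Fin m, n l.succ

/-- The parameter space `Θ(h)`: slopes with `‖β⁽⁰⁾ - β⁽ˡ⁾‖_K ≤ h` for every task. -/
def Theta (m : ℕ) (H : Type*) [NormedAddCommGroup H] (h : ℝ) : Set (Fin (m + 1) → H) :=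
  {β | ∀ l, ‖β 0 - β l‖ ≤ h}

/-- The proportion of the observations that come from task `l`. -/
def weight (n : Fin (m + 1) → ℕ) (l : Fin (m + 1)) : ℝ := (n l : ℝ) / ((nS n + n 0 : ℕ) : ℝ)

/-- The equation of the pooled slope: for `b = K^{1/2} f_S` and `β l = K^{1/2} f_l` it reads
`(∑ α_l T⁽ˡ⁾) f_S = ∑ α_l T⁽ˡ⁾ f_l`. -/
def PooledEq (μ : Fin (m + 1) → Measure (L2 𝒯)) (n : Fin (m + 1) → ℕ)
    (β : Fin (m + 1) → H) (b : H) : Prop :=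
  ∑ l, weight n l • sqrtK H (covOp (μ l) (emb b))
    = ∑ l, weight n l • sqrtK H (covOp (μ l) (emb (β l)))

/-- `b` is the pooled slope `β_S`, the population limit of the transfer step: the solution of the
pooled equation (the one of least norm, if there are several). -/
def IsPooledSlope (μ : Fin (m + 1) → Measure (L2 𝒯)) (n : Fin (m + 1) → ℕ)
    (β : Fin (m + 1) → H) (b : H) : Prop :=
  PooledEq μ n β b ∧ ∀ b', PooledEq μ n β b' → ‖b‖ ≤ ‖b'‖

/-- The rate `(n_S + n₀)^{-2r/(2r+1)} + n₀^{-2r/(2r+1)} ξ`, where `ξ = (h / R)^{2/(2r+1)}`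
and `R = ‖β_S‖_K`. -/
def rate (r h R : ℝ) (n : Fin (m + 1) → ℕ) : ℝ :=
  ((nS n + n 0 : ℕ) : ℝ) ^ (-(2 * r) / (2 * r + 1))
    + (n 0 : ℝ) ^ (-(2 * r) / (2 * r + 1)) * (h / R) ^ (2 / (2 * r + 1))

/-- `inf_{β̃} sup_β P_β(𝓔(β̃) ≥ a · rate)`, the infimum over all estimators and the supremum over
all `β ∈ Θ(h)` whose pooled slope `β_S` exists and satisfies `‖β_S‖_K ∈ A`. -/
def minimaxProb (H : Type*) [NormedAddCommGroup H] [InnerProductSpace ℝ H] [CompleteSpace H]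
    [RKHS ℝ H 𝒯 ℝ] [ContinuousKernel H]
    (μ : Fin (m + 1) → Measure (L2 𝒯)) (v : Fin (m + 1) → ℝ≥0) (r h : ℝ) (A : Set ℝ)
    (n : Fin (m + 1) → ℕ) (a : ℝ) : ℝ≥0∞ :=
  ⨅ (est : Data 𝒯 n → L2 𝒯) (_ : Measurable est),
    ⨆ (β : Fin (m + 1) → H) (b : H) (_ : β ∈ Theta m H h) (_ : IsPooledSlope μ n β b)
      (_ : ‖b‖ ∈ A),
      dataLaw μ v n β {d | a * rate r h ‖b‖ n ≤ excessRisk (μ 0) (est d) (β 0)}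

end Model

end FLR

end

open FLR

namespace FLR

/-! ### Product measures, densities and change of measure -/

section Measures

/-! Let N = n_S + n₀. Giving every task the same slope β is allowed in Θ(h) for each h ≥ 0, and all
N observations then inform about one slope. Over slopes of norm R this costs a risk of order
R^{2/(2r+1)} N^{-2r/(2r+1)}. The term of the rate with ξ needs no construction of its own: R ≥ h
(N/n₀)^r makes it at most the first term (`rate_le_of_large_radius`), and for a fixed R it is of the
same order when n_S = O(n₀) (`rate_le_of_comparable`).

The slopes are β_ω = (R/√D) ∑ ω_k u_k over signs ω, with u_k orthonormal in H(K) and spanned by the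
directions e_j, D ≤ j ≤ 2D+m, that correspond to the eigenfunctions φ_j
(`exists_orthonormal_emb_eq`). These directions are orthogonal to the kernel of the pooled equation,
so a common slope β_ω is its own pooled slope (`isPooledSlope_const`). If an estimate has risk below
s_{2D+m} R²/8 for both ω and ω', then ω and ω' are strongly correlated, and few signs are
(`card_correlated_le`).

Each law is compared with the law of slope 0. The covariates have only second moments, so the
likelihood ratio may fail to be square integrable; `withDensity_le_of_sq_le` cuts off the event
where the information S = ∑ ⟪X, β⟫²/σ² exceeds t, and Markov's inequality bounds that event
(`dataLaw_le`). Averaged over ω, the expected information is of order N R² D^{-2r}, by the diagonal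
bound of `exists_diagonal_le`, which is all that is used of the two conditions on the sources.
Taking D^{2r+1} ≥ B R² N with B large makes it a small fraction of D, so the probability of small
risk is small, not merely below 1. -/

theorem lintegral_pi_prod {ι : Type*} [Fintype ι] {X : ι → Type*} [∀ i, MeasurableSpace (X i)]
    (ν : (i : ι) → Measure (X i)) [∀ i, IsProbabilityMeasure (ν i)]
    {f : (i : ι) → X i → ℝ≥0∞} (hf : ∀ i, Measurable (f i)) :
    ∫⁻ x, ∏ i, f i (x i) ∂(Measure.pi ν) = ∏ i, ∫⁻ y, f i y ∂(ν i) := by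
  rw [lintegral_prod_eq_prod_lintegral_of_indepFun Finset.univ
    (fun i (x : (i : ι) → X i) => f i (x i)) (iIndepFun_pi fun i => (hf i).aemeasurable)
    fun i => (hf i).comp (measurable_pi_apply i)]
  refine Finset.prod_congr rfl fun i _ => ?_
  exact (measurePreserving_eval ν i).lintegral_comp (hf i)

theorem pi_eq_withDensity {ι : Type*} [Fintype ι] {X : ι → Type*} [∀ i, MeasurableSpace (X i)]
    (ν ν' : (i : ι) → Measure (X i)) [∀ i, IsProbabilityMeasure (ν i)]
    [∀ i, IsProbabilityMeasure (ν' i)]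
    {f : (i : ι) → X i → ℝ≥0∞} (hf : ∀ i, Measurable (f i))
    (h : ∀ i, ν' i = (ν i).withDensity (f i)) :
    Measure.pi ν' = (Measure.pi ν).withDensity fun x => ∏ i, f i (x i) := by
  refine Measure.pi_eq fun s hs => ?_
  rw [withDensity_apply _ (MeasurableSet.univ_pi hs),
    ← lintegral_indicator (MeasurableSet.univ_pi hs)]
  have h1 : ∀ x : (i : ι) → X i, (Set.univ.pi s).indicator (fun x => ∏ i, f i (x i)) x
      = ∏ i, (s i).indicator (f i) (x i) := by
    intro x
    by_cases hx : x ∈ Set.univ.pi s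
    · rw [Set.indicator_of_mem hx]
      exact Finset.prod_congr rfl fun i _ => (Set.indicator_of_mem (hx i trivial) _).symm
    · rw [Set.indicator_of_notMem hx]
      obtain ⟨i, hi⟩ : ∃ i, x i ∉ s i := by simpa [Set.mem_pi] using hx
      exact (Finset.prod_eq_zero (Finset.mem_univ i) (Set.indicator_of_notMem hi _)).symm
  simp_rw [h1]
  rw [lintegral_pi_prod ν fun i => (hf i).indicator (hs i)]
  refine Finset.prod_congr rfl fun i _ => ?_
  rw [lintegral_indicator (hs i), h i, withDensity_apply _ (hs i)]

/-- A change of measure bound which needs a second moment of the density only after tilting it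
by `exp (-S)`. -/
theorem withDensity_le_of_sq_le {Ω : Type*} [MeasurableSpace Ω] (Q : Measure Ω)
    {L G S : Ω → ℝ≥0∞} (hG : Measurable G)
    (hS : Measurable S) {t : ℝ}
    (hLG : ∀ x, S x ≤ ENNReal.ofReal t → L x ^ 2 ≤ ENNReal.ofReal (Real.exp t) * G x)
    (hG1 : ∫⁻ x, G x ∂Q ≤ 1) {A : Set Ω} (hA : MeasurableSet A) :
    Q.withDensity L A ≤ Q.withDensity L {x | ENNReal.ofReal t < S x}
      + ENNReal.ofReal (Real.exp (2 * t)) * Q A + ENNReal.ofReal (Real.exp (-t)) := by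
  have hB : MeasurableSet {x | ENNReal.ofReal t < S x} := measurableSet_lt measurable_const hS
  set B := {x | ENNReal.ofReal t < S x} with hBdef
  have h1 : Q.withDensity L A ≤ Q.withDensity L B + Q.withDensity L (A \ B) :=
    (measure_mono (by intro x hx; by_cases h : x ∈ B <;> simp [h, hx])).trans
      (measure_union_le B (A \ B))
  refine h1.trans ?_
  rw [add_assoc]
  gcongr
  rw [withDensity_apply _ (hA.diff hB)]
  -- Off `B`, either L ≤ e^{2t}, or L ≤ e^{-2t} L² ≤ e^{-t} G.
  have h2 : ∀ x ∈ A \ B, L x ≤ ENNReal.ofReal (Real.exp (2 * t))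
      + ENNReal.ofReal (Real.exp (-t)) * G x := by
    intro x hx
    have hx' : S x ≤ ENNReal.ofReal t := not_lt.mp hx.2
    by_cases hc : L x ≤ ENNReal.ofReal (Real.exp (2 * t))
    · exact hc.trans le_self_add
    · push Not at hc
      refine le_trans ?_ (le_add_self)
      have h3 := hLG x hx'
      have h4 : ENNReal.ofReal (Real.exp (2 * t)) * L x ≤
          ENNReal.ofReal (Real.exp t) * G x := by
        refine le_trans ?_ h3
        rw [sq]
        gcongr
      have h5 : ENNReal.ofReal (Real.exp (-t)) * G x = ENNReal.ofReal (Real.exp (-(2 * t))) *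
          (ENNReal.ofReal (Real.exp t) * G x) := by
        rw [← mul_assoc, ← ENNReal.ofReal_mul (Real.exp_nonneg _), ← Real.exp_add]
        ring_nf
      have h6 : L x = ENNReal.ofReal (Real.exp (-(2 * t))) *
          (ENNReal.ofReal (Real.exp (2 * t)) * L x) := by
        rw [← mul_assoc, ← ENNReal.ofReal_mul (Real.exp_nonneg _), ← Real.exp_add]
        simp
      rw [h5]
      calc L x = _ := h6
        _ ≤ _ := by gcongr
  calc ∫⁻ x in A \ B, L x ∂Q
      ≤ ∫⁻ x in A \ B, (ENNReal.ofReal (Real.exp (2 * t))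
          + ENNReal.ofReal (Real.exp (-t)) * G x) ∂Q :=
        setLIntegral_mono ((hG.const_mul _).const_add _) h2
    _ = ENNReal.ofReal (Real.exp (2 * t)) * Q (A \ B)
          + ENNReal.ofReal (Real.exp (-t)) * ∫⁻ x in A \ B, G x ∂Q := by
        rw [lintegral_add_left measurable_const, lintegral_const_mul _ hG]
        simp
    _ ≤ ENNReal.ofReal (Real.exp (2 * t)) * Q A + ENNReal.ofReal (Real.exp (-t)) * 1 := by
        gcongr
        · exact Set.sdiff_subset
        · exact (setLIntegral_le_lintegral _ _).trans hG1
    _ = _ := by rw [mul_one]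

theorem gaussianReal_eq_withDensity (c : ℝ) {v : ℝ≥0} (hv : 0 < v) :
    gaussianReal c v = (gaussianReal 0 v).withDensity
      fun y => ENNReal.ofReal (Real.exp (c * y / v - c ^ 2 / (2 * v))) := by
  rw [gaussianReal_of_var_ne_zero c hv.ne', gaussianReal_of_var_ne_zero 0 hv.ne',
    ← withDensity_mul _ (measurable_gaussianPDF 0 v) (by fun_prop)]
  congr 1
  funext y
  have hv' : (v : ℝ) ≠ 0 := by exact_mod_cast hv.ne'
  rw [Pi.mul_apply, gaussianPDF, gaussianPDF,
    ← ENNReal.ofReal_mul (gaussianPDFReal_nonneg _ _ _), gaussianPDFReal, gaussianPDFReal,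
    mul_assoc _ (Real.exp _) (Real.exp _), ← Real.exp_add]
  congr 3
  field_simp
  ring

/-- The integrand is the density of N(2c, v) with respect to N(0, v): the squared likelihood ratio
for the mean c, multiplied by exp(-c²/v). -/
theorem lintegral_gaussianReal_tilt (c : ℝ) {v : ℝ≥0} (hv : 0 < v) :
    ∫⁻ y, ENNReal.ofReal (Real.exp (2 * c * y / v - 2 * c ^ 2 / v)) ∂(gaussianReal 0 v) = 1 := by
  have h := measure_univ (μ := gaussianReal (2 * c) v)
  rw [gaussianReal_eq_withDensity _ hv, withDensity_apply _ MeasurableSet.univ,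
    Measure.restrict_univ] at h
  rw [← h]
  refine lintegral_congr fun y => ?_
  have hv' : (v : ℝ) ≠ 0 := by exact_mod_cast hv.ne'
  congr 2
  field_simp

end Measures

/-! ### The sign cube -/

section Cube

/-- The sign attached to a bit. -/
def sgn (b : Bool) : ℝ := if b then 1 else -1

theorem sgn_mul_self (b : Bool) : sgn b * sgn b = 1 := by cases b <;> simp [sgn]

theorem sgn_not (b : Bool) : sgn (!b) = -sgn b := by cases b <;> simp [sgn]

theorem sum_sgn_mul_sgn {ι : Type*} [Fintype ι] [DecidableEq ι] (i j : ι) :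
    ∑ ω : ι → Bool, sgn (ω i) * sgn (ω j) = if i = j then (2 : ℝ) ^ Fintype.card ι else 0 := by
  split_ifs with h
  · subst h
    simp [sgn_mul_self]
  -- Flipping the `i`-th bit changes the sign of the term, so the terms cancel in pairs.
  · refine Finset.sum_involution (fun ω _ => Function.update ω i (!ω i)) ?_ ?_ ?_ ?_
    · intro ω _
      rw [Function.update_self, Function.update_of_ne (Ne.symm h), sgn_not]
      ring
    · intro ω _ _ he
      have := congrFun he i
      simp at this
    · simp
    · intro ω _
      simp

theorem sum_sq_sum_sgn {ι : Type*} [Fintype ι] [DecidableEq ι] (x : ι → ℝ) :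
    ∑ ω : ι → Bool, (∑ i, sgn (ω i) * x i) ^ 2 = 2 ^ Fintype.card ι * ∑ i, x i ^ 2 := by
  have h1 : ∀ ω : ι → Bool, (∑ i, sgn (ω i) * x i) ^ 2
      = ∑ i, ∑ j, (sgn (ω i) * sgn (ω j)) * (x i * x j) := by
    intro ω
    rw [sq, Finset.sum_mul_sum]
    exact Finset.sum_congr rfl fun i _ => Finset.sum_congr rfl fun j _ => by ring
  simp_rw [h1]
  rw [Finset.sum_comm, Finset.mul_sum]
  refine Finset.sum_congr rfl fun i _ => ?_
  rw [Finset.sum_comm]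
  simp_rw [← Finset.sum_mul, sum_sgn_mul_sgn]
  simp [sq]

/-- Chernoff's bound: the average of exp(∑ ω₀ᵢωᵢ) is (cosh 1)^D ≤ e^{D/2}, and the threshold 3D/4
leaves e^{D/2 - 3D/4} = e^{-D/4}. -/
theorem card_correlated_le {ι : Type*} [Fintype ι] [DecidableEq ι] (ω₀ : ι → Bool) :
    ((Finset.univ.filter fun ω : ι → Bool =>
      3 / 4 * (Fintype.card ι : ℝ) < ∑ i, sgn (ω₀ i) * sgn (ω i)).card : ℝ)
      ≤ 2 ^ Fintype.card ι * Real.exp (-(Fintype.card ι : ℝ) / 4) := by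
  set D := Fintype.card ι with hD
  have h1 : ∑ ω : ι → Bool, Real.exp (∑ i, sgn (ω₀ i) * sgn (ω i))
      = (2 * Real.cosh 1) ^ D := by
    have h2 : ∀ i, ∑ b : Bool, Real.exp (sgn (ω₀ i) * sgn b) = 2 * Real.cosh 1 := by
      intro i
      rw [Real.cosh_eq, Fintype.sum_bool]
      cases ω₀ i <;> simp [sgn] <;> ring
    simp_rw [Real.exp_sum]
    rw [← Fintype.piFinset_univ,
      ← Finset.prod_univ_sum _ fun i b => Real.exp (sgn (ω₀ i) * sgn b)]
    simp_rw [h2]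
    simp [hD]
  have h3 : ((Finset.univ.filter fun ω : ι → Bool =>
      3 / 4 * (D : ℝ) < ∑ i, sgn (ω₀ i) * sgn (ω i)).card : ℝ) * Real.exp (3 / 4 * D)
      ≤ ∑ ω : ι → Bool, Real.exp (∑ i, sgn (ω₀ i) * sgn (ω i)) := by
    rw [← nsmul_eq_mul]
    refine (Finset.card_nsmul_le_sum _ _ _ ?_).trans
      (Finset.sum_le_sum_of_subset_of_nonneg (Finset.filter_subset _ _)
        fun _ _ _ => Real.exp_nonneg _)
    intro ω hω
    exact Real.exp_le_exp.mpr (Finset.mem_filter.mp hω).2.le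
  have h4 : (2 * Real.cosh 1) ^ D ≤ 2 ^ D * Real.exp (D / 2) := by
    rw [mul_pow]
    gcongr
    have : Real.exp ((D : ℝ) / 2) = Real.exp (1 ^ 2 / 2) ^ D := by
      rw [← Real.exp_nat_mul]
      ring_nf
    rw [this]
    gcongr
    exact Real.cosh_le_exp_half_sq 1
  have h5 : Real.exp ((D : ℝ) / 2) = Real.exp (-(D : ℝ) / 4) * Real.exp (3 / 4 * D) := by
    rw [← Real.exp_add]
    ring_nf
  refine le_of_mul_le_mul_right ?_ (Real.exp_pos (3 / 4 * (D : ℝ)))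
  calc _ ≤ _ := h3
    _ = _ := h1
    _ ≤ _ := h4
    _ = _ := by rw [h5, mul_assoc]

/-- If the acceptance regions `A ω` of a family of measures indexed by the sign cube are shared
only by strongly correlated signs, and each `P ω` is close to a common `Q`, then some `P ω` gives
small mass to its acceptance region. -/
theorem exists_sign_measure_le {Ω : Type*} [MeasurableSpace Ω] {D : ℕ}
    (P : (Fin D → Bool) → Measure Ω) (Q : Measure Ω) [IsProbabilityMeasure Q]
    {A : (Fin D → Bool) → Set Ω} (hA : ∀ ω, MeasurableSet (A ω))
    (hsep : ∀ x ω ω', x ∈ A ω → x ∈ A ω' → 3 / 4 * (D : ℝ) < ∑ i, sgn (ω i) * sgn (ω' i))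
    {B : (Fin D → Bool) → ℝ} (hB0 : ∀ ω, 0 ≤ B ω) {η : ℝ} (hB : ∑ ω, B ω ≤ 2 ^ D * η)
    (hP : ∀ ω, P ω (A ω) ≤ ENNReal.ofReal (B ω)
      + ENNReal.ofReal (Real.exp (2 * (D / 16))) * Q (A ω)
      + ENNReal.ofReal (Real.exp (-(D / 16)))) :
    ∃ ω, P ω (A ω) ≤ ENNReal.ofReal (η + 2 * Real.exp (-(D / 16))) := by
  by_contra! hcon
  have hη : 0 ≤ η := by
    have h : 0 ≤ ∑ ω, B ω := Finset.sum_nonneg fun ω _ => hB0 ω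
    have : (0 : ℝ) < 2 ^ D := by positivity
    nlinarith [nonneg_of_mul_nonneg_right (h.trans hB) this]
  -- All regions containing a point x belong to signs correlated with any one of them, so x is
  -- covered at most as often as `card_correlated_le` allows.
  have hQ : ∑ ω, Q (A ω) ≤ ENNReal.ofReal (2 ^ D * Real.exp (-(D : ℝ) / 4)) := by
    have h1 : ∑ ω, Q (A ω) = ∫⁻ x, ∑ ω, (A ω).indicator 1 x ∂Q := by
      rw [lintegral_finsetSum]
      · exact Finset.sum_congr rfl fun ω _ => (lintegral_indicator_one (hA ω)).symm
      · exact fun ω _ => measurable_one.indicator (hA ω)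
    rw [h1]
    have h2 : ∀ x, ∑ ω, (A ω).indicator (1 : Ω → ℝ≥0∞) x
        ≤ ENNReal.ofReal (2 ^ D * Real.exp (-(D : ℝ) / 4)) := by
      intro x
      classical
      by_cases hx : ∃ ω₀, x ∈ A ω₀
      · obtain ⟨ω₀, hω₀⟩ := hx
        have h3 := card_correlated_le ω₀
        rw [Fintype.card_fin] at h3
        refine le_trans ?_ (ENNReal.ofReal_le_ofReal h3)
        rw [ENNReal.ofReal_natCast]
        have h4 : ∑ ω, (A ω).indicator (1 : Ω → ℝ≥0∞) x
            = ((Finset.univ.filter fun ω => x ∈ A ω).card : ℝ≥0∞) := by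
          simp [Set.indicator_apply, Finset.sum_boole]
        rw [h4]
        exact_mod_cast Finset.card_le_card fun ω hω => by
          simp only [Finset.mem_filter, Finset.mem_univ, true_and] at hω ⊢
          exact hsep x ω₀ ω hω₀ hω
      · push Not at hx
        simp [Set.indicator_of_notMem (hx _)]
    calc _ ≤ ∫⁻ _, ENNReal.ofReal (2 ^ D * Real.exp (-(D : ℝ) / 4)) ∂Q := lintegral_mono h2
      _ = _ := by simp
  have hsum : ∑ _ω : Fin D → Bool, ENNReal.ofReal (η + 2 * Real.exp (-(D / 16)))
      < ∑ ω, P ω (A ω) :=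
    ENNReal.sum_lt_sum_of_nonempty Finset.univ_nonempty fun ω _ => hcon ω
  have hup : ∑ ω, P ω (A ω) ≤ ∑ _ω : Fin D → Bool, ENNReal.ofReal
      (η + 2 * Real.exp (-(D / 16))) := by
    calc ∑ ω, P ω (A ω) ≤ ∑ ω, (ENNReal.ofReal (B ω)
          + ENNReal.ofReal (Real.exp (2 * (D / 16))) * Q (A ω)
          + ENNReal.ofReal (Real.exp (-(D / 16)))) := Finset.sum_le_sum fun ω _ => hP ω
      _ = ENNReal.ofReal (∑ ω, B ω)
          + ENNReal.ofReal (Real.exp (2 * (D / 16))) * ∑ ω, Q (A ω)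
          + ENNReal.ofReal (2 ^ D * Real.exp (-(D / 16))) := by
        rw [Finset.sum_add_distrib, Finset.sum_add_distrib, Finset.mul_sum,
          ENNReal.ofReal_sum_of_nonneg fun ω _ => hB0 ω]
        congr 1
        rw [ENNReal.ofReal_mul (by positivity)]
        simp
      _ ≤ ENNReal.ofReal (2 ^ D * η)
          + ENNReal.ofReal (Real.exp (2 * (D / 16)))
            * ENNReal.ofReal (2 ^ D * Real.exp (-(D : ℝ) / 4))
          + ENNReal.ofReal (2 ^ D * Real.exp (-(D / 16))) := by
        gcongr
      -- With t = D/16 the loss e^{2t} = e^{D/8} stays below the counting gain e^{-D/4}, leaving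
      -- e^{-D/8}.
      _ = ENNReal.ofReal (2 ^ D * η + 2 ^ D * Real.exp (-(D / 8))
          + 2 ^ D * Real.exp (-(D / 16))) := by
        rw [ENNReal.ofReal_add (by positivity) (by positivity),
          ENNReal.ofReal_add (by positivity) (by positivity),
          ← ENNReal.ofReal_mul (Real.exp_nonneg _)]
        congr 3
        rw [mul_left_comm, ← Real.exp_add]
        ring_nf
      _ ≤ ENNReal.ofReal (2 ^ D * (η + 2 * Real.exp (-(D / 16)))) := by
        refine ENNReal.ofReal_le_ofReal ?_
        have : Real.exp (-((D : ℝ) / 8)) ≤ Real.exp (-(D / 16)) := by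
          refine Real.exp_le_exp.mpr ?_
          have : (0 : ℝ) ≤ D := by positivity
          linarith
        have h2 : (0 : ℝ) < 2 ^ D := by positivity
        nlinarith
      _ = _ := by
        rw [ENNReal.ofReal_mul (by positivity)]
        simp
  exact absurd hsum (not_lt.mpr hup)

end Cube

/-! ### Operators attached to the kernel and the covariates -/

section Operators

variable {𝒯 : Set ℝ}

theorem isPositive_posSqrt_of_ne_zero {E : Type*} [NormedAddCommGroup E] [InnerProductSpace ℝ E]
    {A : E →L[ℝ] E} (h : posSqrt A ≠ 0) :
    (posSqrt A).IsPositive ∧ posSqrt A ∘L posSqrt A = A := by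
  by_cases hex : ∃ B : E →L[ℝ] E, B.IsPositive ∧ B ∘L B = A
  · rw [posSqrt, dif_pos hex]
    exact hex.choose_spec
  · exact absurd (by rw [posSqrt, dif_neg hex]) h

theorem inner_covOp {μ : Measure (L2 𝒯)} [IsProbabilityMeasure μ] (hμ : MemLp id 2 μ)
    (f g : L2 𝒯) : ⟪covOp μ f, g⟫ = ∫ z, ⟪f, z - μ[id]⟫ * ⟪g, z - μ[id]⟫ ∂μ := by
  rw [covOp, InnerProductSpace.continuousLinearMapOfBilin_apply, covarianceBilin_apply hμ]

theorem inner_covOp_comm (μ : Measure (L2 𝒯)) (f g : L2 𝒯) :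
    ⟪covOp μ f, g⟫ = ⟪f, covOp μ g⟫ := by
  rw [real_inner_comm (covOp μ g) f, covOp, InnerProductSpace.continuousLinearMapOfBilin_apply,
    InnerProductSpace.continuousLinearMapOfBilin_apply, covarianceBilin_comm]

theorem inner_covOp_self_nonneg (μ : Measure (L2 𝒯)) (f : L2 𝒯) : 0 ≤ ⟪covOp μ f, f⟫ := by
  rw [covOp, InnerProductSpace.continuousLinearMapOfBilin_apply]
  exact covarianceBilin_self_nonneg f

theorem inner_covOp_eq_zero {μ : Measure (L2 𝒯)} {f : L2 𝒯} (hf : ⟪covOp μ f, f⟫ = 0)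
    (g : L2 𝒯) : ⟪covOp μ g, f⟫ = 0 := by
  by_contra hne
  set b := ⟪covOp μ g, f⟫ with hb
  set a := ⟪covOp μ g, g⟫ with ha
  -- With coefficient x of `f` the form is a + 2xb, linear because `f` is isotropic; this x gives it
  -- the value -1.
  have h := inner_covOp_self_nonneg μ (g + (-(a + 1) / (2 * b)) • f)
  have hb' : ⟪covOp μ f, g⟫ = b := by rw [inner_covOp_comm, real_inner_comm]
  simp only [map_add, map_smul, inner_add_left, inner_add_right, inner_smul_left,
    inner_smul_right, hf, ← hb, ← ha, hb'] at h
  simp only [conj_trivial, mul_zero, add_zero] at h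
  have h2 : -(a + 1) / (2 * b) * b = -(a + 1) / 2 := by field_simp
  linarith

theorem integrable_inner_sq {μ : Measure (L2 𝒯)} (hμ : MemLp id 2 μ) (f : L2 𝒯) :
    Integrable (fun x => ⟪x, f⟫ ^ 2) μ := by
  have h : MemLp (fun x => ⟪id x, f⟫) 2 μ := hμ.inner_const f
  exact h.integrable_sq

/-- The excess risk is an uncentred second moment while the eigenvalues concern the centred one; the
squared mean is the difference. -/
theorem inner_covOp_self_eq_sub {μ : Measure (L2 𝒯)} [IsProbabilityMeasure μ]
    (hμ : MemLp id 2 μ) (f : L2 𝒯) :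
    ⟪covOp μ f, f⟫ = ∫ x, ⟪x, f⟫ ^ 2 ∂μ - ⟪μ[id], f⟫ ^ 2 := by
  have hm : MemLp (fun x => ⟪f, x⟫) 2 μ := hμ.const_inner f
  rw [covOp, InnerProductSpace.continuousLinearMapOfBilin_apply, covarianceBilin_self hμ,
    variance_eq_sub hm]
  have h1 : ∫ x, ⟪f, x⟫ ∂μ = ⟪f, μ[id]⟫ := by
    have := integral_inner (𝕜 := ℝ) (hμ.integrable one_le_two) f
    simpa using this
  rw [h1]
  simp [real_inner_comm]

end Operators

/-! ### The inclusion of H(K) in L²(𝒯), its adjoint and the pooled equation -/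

section Kernel

variable {𝒯 : Set ℝ} [CompactSpace 𝒯]
variable (H : Type*) [NormedAddCommGroup H] [InnerProductSpace ℝ H] [CompleteSpace H]
  [RKHS ℝ H 𝒯 ℝ] [ContinuousKernel H]

theorem abs_apply_le (b : H) (x : 𝒯) : |b x| ≤ √‖kern H‖ * ‖b‖ := by
  have h1 : ‖RKHS.kerFun H x (1 : ℝ)‖ ≤ √‖kern H‖ := by
    refine Real.le_sqrt_of_sq_le ?_
    rw [← real_inner_self_eq_norm_sq, RKHS.kerFun_inner, RKHS.kerFun_apply]
    have h2 : ‖kern H (x, x)‖ ≤ ‖kern H‖ := (kern H).norm_coe_le_norm (x, x)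
    have h3 : kern H (x, x) = RKHS.kernel H x x 1 := rfl
    rw [h3] at h2
    simpa using (le_abs_self _).trans h2
  have h2 : b x = ⟪RKHS.kerFun H x (1 : ℝ), b⟫ := by
    rw [RKHS.kerFun_inner]
    simp
  rw [h2]
  exact (abs_real_inner_le_norm _ _).trans (by gcongr)

/-- The inclusion of `H(K)` in `L²(𝒯)` as a continuous linear map. -/
noncomputable def embCLM : H →L[ℝ] L2 𝒯 :=
  (ContinuousMap.toLp 2 (leb 𝒯) ℝ : C(𝒯, ℝ) →L[ℝ] L2 𝒯) ∘L
    (LinearMap.mkContinuous (σ := RingHom.id ℝ)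
      { toFun := fun b : H => (⟨b, continuous_coe b⟩ : C(𝒯, ℝ))
        map_add' := fun f g => by ext s; simp
        map_smul' := fun c f => by ext s; simp }
      √‖kern H‖
      (fun b => (ContinuousMap.norm_le _ (by positivity)).mpr fun s => abs_apply_le H b s))

variable {H}

theorem embCLM_apply (b : H) : embCLM H b = emb b := rfl

/-- By the reproducing property the inclusion ι sends the kernel function at s to the section K(s,
·); hence ι ι* = L_K. -/
theorem emb_adjoint (g : L2 𝒯) :
    emb ((embCLM H).adjoint g) = integralOp (kern H) g := by
  have h : (⟨(embCLM H).adjoint g, continuous_coe _⟩ : C(𝒯, ℝ)) = kernelIntegral (kern H) g := by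
    ext s
    rw [kernelIntegral_apply]
    have h1 : ((embCLM H).adjoint g) s = ⟪RKHS.kerFun H s (1 : ℝ), (embCLM H).adjoint g⟫ := by
      rw [RKHS.kerFun_inner]
      simp
    have h2 : embCLM H (RKHS.kerFun H s (1 : ℝ)) = sectionL2 (kern H) s := by
      rw [embCLM_apply, emb, sectionL2]
      change ContinuousMap.toLp 2 (leb 𝒯) ℝ _ = ContinuousMap.toLp 2 (leb 𝒯) ℝ _
      congr 1
      ext t
      change RKHS.kerFun H s (1 : ℝ) t = RKHS.kernel H s t 1
      have h3 := RKHS.kernel_inner (𝕜 := ℝ) H s t (1 : ℝ) 1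
      rw [RKHS.kerFun_inner, RKHS.kerFun_apply] at h3
      rw [RKHS.kerFun_apply]
      simpa using h3.symm
    change ((embCLM H).adjoint g) s = _
    rw [h1, ContinuousLinearMap.adjoint_inner_right, h2]
  change ContinuousMap.toLp 2 (leb 𝒯) ℝ _ = _
  rw [h]
  rfl

theorem inner_sqrtK_comm
    (hK : (sqrtK H).IsPositive ∧ sqrtK H ∘L sqrtK H = integralOp (kern H))
    (f g : L2 𝒯) : ⟪sqrtK H f, g⟫ = ⟪f, sqrtK H g⟫ :=
  hK.1.isSymmetric f g

/-- Both sides equal ⟪L_K f, g⟫, because L_K is ι ι* as well as the square of K^{1/2}. This replaces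
K^{-1/2} in passing between L²(𝒯) and H(K). -/
theorem inner_adjoint_adjoint
    (hK : (sqrtK H).IsPositive ∧ sqrtK H ∘L sqrtK H = integralOp (kern H))
    (f g : L2 𝒯) :
    ⟪(embCLM H).adjoint f, (embCLM H).adjoint g⟫ = ⟪sqrtK H f, sqrtK H g⟫ := by
  rw [ContinuousLinearMap.adjoint_inner_left, embCLM_apply, emb_adjoint, ← hK.2,
    inner_sqrtK_comm hK]
  rfl

theorem inner_opT
    (hK : (sqrtK H).IsPositive ∧ sqrtK H ∘L sqrtK H = integralOp (kern H))
    (μ : Measure (L2 𝒯)) (f g : L2 𝒯) :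
    ⟪opT H μ f, g⟫ = ⟪covOp μ (sqrtK H f), sqrtK H g⟫ :=
  inner_sqrtK_comm hK _ _

/-- Pairing the equation with b gives a vanishing sum of nonnegative covariance forms, so the form
of the target vanishes at b, and b lies in the kernel of that form. -/
theorem inner_eq_zero_of_pooled_eq_zero
    (hK : (sqrtK H).IsPositive ∧ sqrtK H ∘L sqrtK H = integralOp (kern H))
    {m : ℕ} {μ : Fin (m + 1) → Measure (L2 𝒯)}
    {w : Fin (m + 1) → ℝ} (hw : ∀ l, 0 ≤ w l) (hw0 : 0 < w 0) {b : H}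
    (hb : ∑ l, w l • sqrtK H (covOp (μ l) (emb b)) = 0) (g : L2 𝒯) :
    ⟪(embCLM H).adjoint (covOp (μ 0) g), b⟫ = 0 := by
  have h1 : sqrtK H (∑ l, w l • covOp (μ l) (emb b)) = 0 := by
    rw [map_sum, ← hb]
    exact Finset.sum_congr rfl fun l _ => map_smul _ _ _
  have h2 : (embCLM H).adjoint (∑ l, w l • covOp (μ l) (emb b)) = 0 := by
    rw [← inner_self_eq_zero (𝕜 := ℝ), inner_adjoint_adjoint hK, h1, inner_zero_left]
  have h3 : ∑ l, w l * ⟪covOp (μ l) (emb b), emb b⟫ = 0 := by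
    have h4 : ⟪∑ l, w l • covOp (μ l) (emb b), emb b⟫ = 0 := by
      rw [← embCLM_apply b, ← ContinuousLinearMap.adjoint_inner_left, embCLM_apply, h2,
        inner_zero_left]
    rw [sum_inner] at h4
    simpa [inner_smul_left] using h4
  have h5 := (Finset.sum_eq_zero_iff_of_nonneg fun l _ =>
    mul_nonneg (hw l) (inner_covOp_self_nonneg (μ l) (emb b))).mp h3 0 (Finset.mem_univ 0)
  rw [ContinuousLinearMap.adjoint_inner_left, embCLM_apply]
  exact inner_covOp_eq_zero ((mul_eq_zero.mp h5).resolve_left hw0.ne') g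

/-- The eigenfunctions of the target operator with positive eigenvalue are the images under
`K^{-1/2}` of an orthonormal family of `H(K)`, which is orthogonal to everything that the pooled
equation does not see. -/
theorem exists_orthonormal_emb_eq
    (hK : (sqrtK H).IsPositive ∧ sqrtK H ∘L sqrtK H = integralOp (kern H))
    {m : ℕ} (μ : Fin (m + 1) → Measure (L2 𝒯))
    {s : ℕ → ℝ} {φ : ℕ → L2 𝒯} (hs : IsEigenSystem (opT H (μ 0)) s φ) (hpos : ∀ j, 0 < s j) :
    ∃ e : ℕ → H, Orthonormal ℝ e ∧ (∀ j, emb (e j) = sqrtK H (φ j)) ∧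
      ∀ w : Fin (m + 1) → ℝ, (∀ l, 0 ≤ w l) → 0 < w 0 → ∀ b : H,
        ∑ l, w l • sqrtK H (covOp (μ l) (emb b)) = 0 → ∀ j, ⟪e j, b⟫ = 0 := by
  have hroot : ∀ j, sqrtK H ((s j)⁻¹ • covOp (μ 0) (sqrtK H (φ j))) = φ j := by
    intro j
    rw [map_smul]
    have h := hs.eigen j
    change sqrtK H (covOp (μ 0) (sqrtK H (φ j))) = _ at h
    rw [h, smul_smul, inv_mul_cancel₀ (hpos j).ne', one_smul]
  -- The eigenvalue equation writes φ_j as K^{1/2} g_j with g_j = s_j⁻¹ L_C K^{1/2} φ_j, so ι* g_j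
  -- plays the part of K^{1/2} φ_j inside H(K).
  refine ⟨fun j => (embCLM H).adjoint ((s j)⁻¹ • covOp (μ 0) (sqrtK H (φ j))), ?_, ?_, ?_⟩
  · rw [orthonormal_iff_ite]
    intro i j
    rw [inner_adjoint_adjoint hK, hroot, hroot]
    exact orthonormal_iff_ite.mp hs.orthonormal i j
  · intro j
    rw [emb_adjoint, ← hK.2, ContinuousLinearMap.comp_apply, hroot]
  · intro w hw hw0 b hb j
    beta_reduce
    rw [map_smul, inner_smul_left, inner_eq_zero_of_pooled_eq_zero hK hw hw0 hb, mul_zero]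

/-- Solutions differ from β by elements of the kernel, which are orthogonal to β; by Pythagoras β
has the least norm. -/
theorem isPooledSlope_const {m : ℕ} {μ : Fin (m + 1) → Measure (L2 𝒯)} {n : Fin (m + 1) → ℕ}
    {β : H} (h : ∀ b : H, ∑ l, weight n l • sqrtK H (covOp (μ l) (emb b)) = 0 → ⟪β, b⟫ = 0) :
    IsPooledSlope μ n (fun _ => β) β := by
  refine ⟨rfl, fun b' hb' => ?_⟩
  have h1 : ⟪β, b' - β⟫ = 0 := by
    refine h _ ?_
    rw [PooledEq] at hb'
    simp only [← embCLM_apply] at hb' ⊢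
    simp only [map_sub, smul_sub, Finset.sum_sub_distrib]
    exact sub_eq_zero.mpr hb'
  have h2 := norm_add_sq_eq_norm_sq_add_norm_sq_real h1
  rw [add_sub_cancel] at h2
  nlinarith [norm_nonneg b', norm_nonneg β, norm_nonneg (b' - β)]

end Kernel

/-! ### Size of the diagonals -/

section Decay

variable {𝒯 : Set ℝ} [CompactSpace 𝒯]
variable {H : Type*} [NormedAddCommGroup H] [InnerProductSpace ℝ H] [CompleteSpace H]
  [RKHS ℝ H 𝒯 ℝ] [ContinuousKernel H]

theorem eigenvalue_pos {s : ℕ → ℝ} (hs : Antitone s) {r : ℝ}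
    (hdecay : s =Θ[atTop] fun j : ℕ => (j : ℝ) ^ (-(2 * r))) (hnn : ∀ j, 0 ≤ s j) (j : ℕ) :
    0 < s j := by
  obtain ⟨c, -, hc⟩ := hdecay.2.exists_pos
  obtain ⟨k, hk1, hk2⟩ := (hc.bound.and (eventually_ge_atTop (j + 1))).exists
  refine lt_of_lt_of_le ?_ (hs (show j ≤ k by omega))
  refine lt_of_le_of_ne (hnn k) fun h0 => ?_
  rw [← h0, norm_zero, mul_zero] at hk1
  have : (0 : ℝ) < (k : ℝ) ^ (-(2 * r)) :=
    Real.rpow_pos_of_pos (by exact_mod_cast (by omega : 0 < k)) _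
  exact absurd (norm_le_zero_iff.mp hk1) this.ne'

/-- If `posSqrt` took its default value 0, the target operator and all its eigenvalues would vanish,
against the polynomial decay from below. -/
theorem sqrtK_spec {μ : Measure (L2 𝒯)} {s : ℕ → ℝ} {φ : ℕ → L2 𝒯}
    (hs : IsEigenSystem (opT H μ) s φ) {r : ℝ}
    (hdecay : s =Θ[atTop] fun j : ℕ => (j : ℝ) ^ (-(2 * r))) :
    (sqrtK H).IsPositive ∧ sqrtK H ∘L sqrtK H = integralOp (kern H) := by
  refine isPositive_posSqrt_of_ne_zero fun h0 => ?_
  have hz : ∀ j, s j = 0 := by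
    intro j
    have h1 := hs.eigen j
    change posSqrt (integralOp (kern H)) _ = _ at h1
    rw [h0, zero_apply] at h1
    exact (smul_eq_zero.mp h1.symm).resolve_right (hs.orthonormal.ne_zero j)
  exact absurd (eigenvalue_pos hs.antitone hdecay (fun j => (hz j).ge) 0) (by rw [hz]; simp)

theorem eigenvalue_nonneg (hK : (sqrtK H).IsPositive ∧ sqrtK H ∘L sqrtK H = integralOp (kern H))
    {μ : Measure (L2 𝒯)} {s : ℕ → ℝ} {φ : ℕ → L2 𝒯}
    (hs : IsEigenSystem (opT H μ) s φ) (j : ℕ) : 0 ≤ s j := by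
  have h1 := inner_covOp_self_nonneg μ (sqrtK H (φ j))
  rw [← inner_opT hK, hs.eigen, inner_smul_left, real_inner_self_eq_norm_sq,
    hs.orthonormal.1 j] at h1
  simpa using h1

/-- Under the Hilbert–Schmidt condition, with S the root of T⁽⁰⁾, the diagonal is ⟪(1 - D) Sφ_j,
Sφ_j⟫ and ‖Sφ_j‖² = s_j; boundedness of D suffices. -/
theorem exists_diagonal_le (hK : (sqrtK H).IsPositive ∧ sqrtK H ∘L sqrtK H = integralOp (kern H))
    {m : ℕ} {μ : Fin (m + 1) → Measure (L2 𝒯)} {s : ℕ → ℝ} {φ : ℕ → L2 𝒯}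
    (hs : IsEigenSystem (opT H (μ 0)) s φ) {r : ℝ}
    (hdecay : s =Θ[atTop] fun j : ℕ => (j : ℝ) ^ (-(2 * r)))
    (hT : CommuteCondition (fun l => opT H (μ l)) s φ ∨ HSCondition (fun l => opT H (μ l))) :
    ∃ C > 0, ∀ᶠ j : ℕ in atTop, ∀ l,
      ⟪opT H (μ l) (φ j), φ j⟫ ≤ C * (j : ℝ) ^ (-(2 * r)) := by
  have hdiag0 : ∀ j, ⟪opT H (μ 0) (φ j), φ j⟫ = s j := by
    intro j
    rw [hs.eigen, inner_smul_left, real_inner_self_eq_norm_sq, hs.orthonormal.1 j]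
    simp
  have hsO : ∀ l, (fun j => ⟪opT H (μ l) (φ j), φ j⟫) =O[atTop] s := by
    intro l
    refine Fin.cases ?_ (fun l => ?_) l
    · simp_rw [hdiag0]
      exact isBigO_refl _ _
    · rcases hT with hT | hT
      · exact (hT l).2
      · obtain ⟨D, -, hD⟩ := hT l
        refine IsBigO.of_bound ‖1 - D‖ (Eventually.of_forall fun j => ?_)
        -- A zero root, default or not, makes the source operator zero by its factorisation.
        by_cases h0 : posSqrt (opT H (μ 0)) = 0
        · simp only [hD, h0]
          simp
          positivity
        · obtain ⟨hp, hsq⟩ := isPositive_posSqrt_of_ne_zero h0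
          set S := posSqrt (opT H (μ 0)) with hS
          have h1 : ⟪opT H (μ l.succ) (φ j), φ j⟫ = ⟪(1 - D) (S (φ j)), S (φ j)⟫ := by
            simp only [hD]
            exact hp.isSymmetric _ _
          have h2 : ‖S (φ j)‖ ^ 2 = s j := by
            rw [← real_inner_self_eq_norm_sq, ← hdiag0 j, ← hsq]
            exact (hp.isSymmetric _ _).symm
          rw [h1, Real.norm_eq_abs, Real.norm_of_nonneg (eigenvalue_nonneg hK hs j), ← h2]
          calc _ ≤ ‖(1 - D) (S (φ j))‖ * ‖S (φ j)‖ := abs_real_inner_le_norm _ _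
            _ ≤ (‖1 - D‖ * ‖S (φ j)‖) * ‖S (φ j)‖ := by
              gcongr
              exact (1 - D).le_opNorm _
            _ = _ := by ring
  choose C hC0 hC using fun l => ((hsO l).trans hdecay.1).exists_pos
  refine ⟨∑ l, C l, Finset.sum_pos (fun l _ => hC0 l) Finset.univ_nonempty, ?_⟩
  filter_upwards [eventually_all.mpr fun l => (hC l).bound] with j hj l
  have h1 : (0 : ℝ) ≤ (j : ℝ) ^ (-(2 * r)) := by positivity
  have h2 := (le_abs_self _).trans (hj l)
  rw [Real.norm_of_nonneg h1] at h2
  refine h2.trans ?_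
  gcongr
  exact Finset.single_le_sum (fun l _ => (hC0 l).le) (Finset.mem_univ l)

end Decay

/-! ### Likelihood ratios in the regression model -/

section Model

theorem measurable_inner_left {𝒯 : Set ℝ} (f : L2 𝒯) : Measurable fun x : L2 𝒯 => ⟪x, f⟫ :=
  (continuous_id.inner continuous_const).measurable

variable {𝒯 : Set ℝ} [CompactSpace 𝒯] {m : ℕ}
variable {H : Type*} [NormedAddCommGroup H] [InnerProductSpace ℝ H] [CompleteSpace H]
  [RKHS ℝ H 𝒯 ℝ] [ContinuousKernel H]

theorem measurable_obs (β : H) :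
    Measurable fun p : L2 𝒯 × ℝ => (p.1, ⟪p.1, emb β⟫ + p.2) :=
  measurable_fst.prodMk (((measurable_inner_left _).comp measurable_fst).add measurable_snd)

instance (μ : Measure (L2 𝒯)) [IsProbabilityMeasure μ] (v : ℝ≥0) (β : H) :
    IsProbabilityMeasure (obsLaw μ v β) :=
  Measure.isProbabilityMeasure_map (measurable_obs β).aemeasurable

instance (μ : Fin (m + 1) → Measure (L2 𝒯)) [∀ l, IsProbabilityMeasure (μ l)]
    (v : Fin (m + 1) → ℝ≥0) (n : Fin (m + 1) → ℕ) (β : Fin (m + 1) → H) :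
    IsProbabilityMeasure (dataLaw μ v n β) := by
  unfold dataLaw
  infer_instance

theorem lintegral_obsLaw (μ : Measure (L2 𝒯)) [IsProbabilityMeasure μ] (v : ℝ≥0) (β : H)
    {F : L2 𝒯 × ℝ → ℝ≥0∞} (hF : Measurable F) :
    ∫⁻ p, F p ∂(obsLaw μ v β) = ∫⁻ x, ∫⁻ y, F (x, y) ∂(gaussianReal ⟪x, emb β⟫ v) ∂μ := by
  have hF' : Measurable fun p : L2 𝒯 × ℝ => F (p.1, ⟪p.1, emb β⟫ + p.2) :=
    hF.comp (measurable_obs β)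
  rw [obsLaw, lintegral_map hF (measurable_obs β), lintegral_prod _ hF'.aemeasurable]
  refine lintegral_congr fun x => ?_
  have h : gaussianReal ⟪x, emb β⟫ v = (gaussianReal 0 v).map (⟪x, emb β⟫ + ·) := by
    rw [gaussianReal_map_const_add, zero_add]
  have hFx : Measurable fun y => F (x, y) := hF.comp measurable_prodMk_left
  rw [h, lintegral_map hFx (measurable_const_add _)]

theorem emb_zero : emb (0 : H) = 0 := by rw [← embCLM_apply, map_zero]

theorem obsLaw_eq_withDensity (μ : Measure (L2 𝒯)) [IsProbabilityMeasure μ] {v : ℝ≥0}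
    (hv : 0 < v) (β : H) :
    obsLaw μ v β = (obsLaw μ v (0 : H)).withDensity fun p => ENNReal.ofReal
      (Real.exp (⟪p.1, emb β⟫ * p.2 / v - ⟪p.1, emb β⟫ ^ 2 / (2 * v))) := by
  have hi : Measurable fun p : L2 𝒯 × ℝ => ⟪p.1, emb β⟫ :=
    (measurable_inner_left _).comp measurable_fst
  have hd : Measurable fun p : L2 𝒯 × ℝ => ENNReal.ofReal
      (Real.exp (⟪p.1, emb β⟫ * p.2 / v - ⟪p.1, emb β⟫ ^ 2 / (2 * v))) := by fun_prop
  refine Measure.ext fun s hs => ?_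
  rw [withDensity_apply _ hs, ← lintegral_indicator hs, lintegral_obsLaw _ _ _ (hd.indicator hs),
    ← lintegral_indicator_one hs, lintegral_obsLaw _ _ _ (measurable_one.indicator hs)]
  refine lintegral_congr fun x => ?_
  have hsx : Measurable fun y : ℝ => s.indicator (1 : L2 𝒯 × ℝ → ℝ≥0∞) (x, y) :=
    (measurable_one.indicator hs).comp measurable_prodMk_left
  rw [gaussianReal_eq_withDensity ⟪x, emb β⟫ hv, lintegral_withDensity_eq_lintegral_mul _
    (by fun_prop) hsx, emb_zero, inner_zero_right]
  refine lintegral_congr fun y => ?_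
  by_cases h : (x, y) ∈ s <;> simp [h]

theorem lintegral_obsLaw_tilt (μ : Measure (L2 𝒯)) [IsProbabilityMeasure μ] {v : ℝ≥0}
    (hv : 0 < v) (β : H) :
    ∫⁻ p, ENNReal.ofReal (Real.exp (2 * ⟪p.1, emb β⟫ * p.2 / v - 2 * ⟪p.1, emb β⟫ ^ 2 / v))
      ∂(obsLaw μ v (0 : H)) = 1 := by
  have hi : Measurable fun p : L2 𝒯 × ℝ => ⟪p.1, emb β⟫ :=
    (measurable_inner_left _).comp measurable_fst
  rw [lintegral_obsLaw _ _ _ (by fun_prop)]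
  simp_rw [emb_zero, inner_zero_right, lintegral_gaussianReal_tilt _ hv]
  simp

theorem lintegral_obsLaw_inner_sq {μ : Measure (L2 𝒯)} [IsProbabilityMeasure μ]
    (hμ : MemLp id 2 μ) (v : ℝ≥0) (β : H) :
    ∫⁻ p, ENNReal.ofReal (⟪p.1, emb β⟫ ^ 2 / v) ∂(obsLaw μ v β)
      = ENNReal.ofReal ((∫ x, ⟪x, emb β⟫ ^ 2 ∂μ) / v) := by
  have hi : Measurable fun p : L2 𝒯 × ℝ => ⟪p.1, emb β⟫ :=
    (measurable_inner_left _).comp measurable_fst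
  rw [lintegral_obsLaw _ _ _ (by fun_prop), ← integral_div,
    ofReal_integral_eq_lintegral_ofReal ((integrable_inner_sq hμ _).div_const _)
      (ae_of_all _ fun x => by positivity)]
  simp

theorem lintegral_dataLaw_coord (μ : Fin (m + 1) → Measure (L2 𝒯))
    [∀ l, IsProbabilityMeasure (μ l)] (v : Fin (m + 1) → ℝ≥0) (n : Fin (m + 1) → ℕ)
    (β : Fin (m + 1) → H) (l : Fin (m + 1)) (i : Fin (n l)) {F : L2 𝒯 × ℝ → ℝ≥0∞}
    (hF : Measurable F) :
    ∫⁻ d, F (d l i) ∂(dataLaw μ v n β) = ∫⁻ p, F p ∂(obsLaw (μ l) (v l) (β l)) := by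
  have hFi : Measurable fun x : Fin (n l) → L2 𝒯 × ℝ => F (x i) :=
    hF.comp (measurable_pi_apply i)
  exact ((measurePreserving_eval (fun l => Measure.pi fun _ : Fin (n l) =>
    obsLaw (μ l) (v l) (β l)) l).lintegral_comp hFi).trans
    ((measurePreserving_eval (fun _ : Fin (n l) => obsLaw (μ l) (v l) (β l)) i).lintegral_comp hF)

theorem dataLaw_eq_withDensity (μ : Fin (m + 1) → Measure (L2 𝒯))
    [∀ l, IsProbabilityMeasure (μ l)] {v : Fin (m + 1) → ℝ≥0} (hv : ∀ l, 0 < v l)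
    (n : Fin (m + 1) → ℕ) (β : Fin (m + 1) → H) :
    dataLaw μ v n β = (dataLaw μ v n fun _ => (0 : H)).withDensity fun d => ∏ l, ∏ i,
      ENNReal.ofReal (Real.exp (⟪(d l i).1, emb (β l)⟫ * (d l i).2 / v l
        - ⟪(d l i).1, emb (β l)⟫ ^ 2 / (2 * v l))) := by
  have hi : ∀ l, Measurable fun p : L2 𝒯 × ℝ => ⟪p.1, emb (β l)⟫ :=
    fun l => (measurable_inner_left _).comp measurable_fst
  have hd : ∀ l, Measurable fun p : L2 𝒯 × ℝ => ENNReal.ofReal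
      (Real.exp (⟪p.1, emb (β l)⟫ * p.2 / v l - ⟪p.1, emb (β l)⟫ ^ 2 / (2 * v l))) := by
    intro l
    have := hi l
    fun_prop
  refine pi_eq_withDensity (fun l => Measure.pi fun _ : Fin (n l) => obsLaw (μ l) (v l) (0 : H))
    (fun l => Measure.pi fun _ : Fin (n l) => obsLaw (μ l) (v l) (β l))
    (f := fun l (x : Fin (n l) → L2 𝒯 × ℝ) => ∏ i, ENNReal.ofReal
    (Real.exp (⟪(x i).1, emb (β l)⟫ * (x i).2 / v l - ⟪(x i).1, emb (β l)⟫ ^ 2 / (2 * v l))))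
    (fun l => ?_) (fun l => ?_)
  · exact Finset.measurable_prod _ fun i _ => (hd l).comp (measurable_pi_apply i)
  · exact pi_eq_withDensity (fun _ : Fin (n l) => obsLaw (μ l) (v l) (0 : H))
      (fun _ : Fin (n l) => obsLaw (μ l) (v l) (β l)) (f := fun _ p => ENNReal.ofReal
      (Real.exp (⟪p.1, emb (β l)⟫ * p.2 / v l - ⟪p.1, emb (β l)⟫ ^ 2 / (2 * v l))))
      (fun _ => hd l) fun _ => obsLaw_eq_withDensity _ (hv l) _

/-- The law of the data with slopes `β` compared with the law with slopes `0`, through the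
expected amount of information. -/
theorem dataLaw_le {μ : Fin (m + 1) → Measure (L2 𝒯)}
    [∀ l, IsProbabilityMeasure (μ l)] (hμ : ∀ l, MemLp id 2 (μ l))
    {v : Fin (m + 1) → ℝ≥0} (hv : ∀ l, 0 < v l)
    (n : Fin (m + 1) → ℕ) (β : Fin (m + 1) → H) {A : Set (Data 𝒯 n)} (hA : MeasurableSet A)
    {t : ℝ} (ht : 0 < t) :
    dataLaw μ v n β A
      ≤ ENNReal.ofReal ((∑ l, n l * ((∫ x, ⟪x, emb (β l)⟫ ^ 2 ∂(μ l)) / v l)) / t)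
      + ENNReal.ofReal (Real.exp (2 * t)) * dataLaw μ v n (fun _ => (0 : H)) A
      + ENNReal.ofReal (Real.exp (-t)) := by
  have hi : ∀ l, Measurable fun p : L2 𝒯 × ℝ => ⟪p.1, emb (β l)⟫ :=
    fun l => (measurable_inner_left _).comp measurable_fst
  have hev : ∀ l (i : Fin (n l)), Measurable fun d : Data 𝒯 n => d l i :=
    fun l i => (measurable_pi_apply i).comp (measurable_pi_apply l)
  -- S is the information carried by the covariates, and G is the density for the slopes 2β relative
  -- to slopes 0; the squared likelihood ratio is e^S G.
  let S : Data 𝒯 n → ℝ≥0∞ := fun d =>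
    ∑ l, ∑ i, ENNReal.ofReal (⟪(d l i).1, emb (β l)⟫ ^ 2 / v l)
  let G : Data 𝒯 n → ℝ≥0∞ := fun d => ∏ l, ∏ i, ENNReal.ofReal
    (Real.exp (2 * ⟪(d l i).1, emb (β l)⟫ * (d l i).2 / v l
      - 2 * ⟪(d l i).1, emb (β l)⟫ ^ 2 / v l))
  have hS1 : ∀ l, Measurable fun p : L2 𝒯 × ℝ => ENNReal.ofReal (⟪p.1, emb (β l)⟫ ^ 2 / v l) := by
    intro l
    have := hi l
    fun_prop
  have hG1 : ∀ l, Measurable fun p : L2 𝒯 × ℝ => ENNReal.ofReal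
      (Real.exp (2 * ⟪p.1, emb (β l)⟫ * p.2 / v l - 2 * ⟪p.1, emb (β l)⟫ ^ 2 / v l)) := by
    intro l
    have := hi l
    fun_prop
  have hS2 : ∀ l (i : Fin (n l)), Measurable fun d : Data 𝒯 n =>
      ENNReal.ofReal (⟪(d l i).1, emb (β l)⟫ ^ 2 / v l) := fun l i => (hS1 l).comp (hev l i)
  have hS : Measurable S := Finset.measurable_sum _ fun l _ => Finset.measurable_sum _
    fun i _ => hS2 l i
  have hG : Measurable G := Finset.measurable_prod _ fun l _ => Finset.measurable_prod _
    fun i _ => (hG1 l).comp (hev l i)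
  have hGint : ∫⁻ d, G d ∂(dataLaw μ v n fun _ => (0 : H)) = 1 := by
    have h1 := lintegral_pi_prod (fun l => Measure.pi fun _ : Fin (n l) =>
      obsLaw (μ l) (v l) (0 : H)) (f := fun l (x : Fin (n l) → L2 𝒯 × ℝ) => ∏ i, ENNReal.ofReal
        (Real.exp (2 * ⟪(x i).1, emb (β l)⟫ * (x i).2 / v l
          - 2 * ⟪(x i).1, emb (β l)⟫ ^ 2 / v l)))
      fun l => Finset.measurable_prod _ fun i _ => (hG1 l).comp (measurable_pi_apply i)
    refine h1.trans (Finset.prod_eq_one fun l _ => ?_)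
    refine (lintegral_pi_prod (fun _ : Fin (n l) => obsLaw (μ l) (v l) (0 : H))
      fun _ => hG1 l).trans (Finset.prod_eq_one fun i _ => lintegral_obsLaw_tilt _ (hv l) _)
  have hSint : ∫⁻ d, S d ∂(dataLaw μ v n β)
      = ENNReal.ofReal (∑ l, n l * ((∫ x, ⟪x, emb (β l)⟫ ^ 2 ∂(μ l)) / v l)) := by
    simp only [S]
    rw [lintegral_finsetSum _ fun l _ => Finset.measurable_sum _
      fun i _ => hS2 l i, ENNReal.ofReal_sum_of_nonneg fun l _ => by positivity]
    refine Finset.sum_congr rfl fun l _ => ?_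
    rw [lintegral_finsetSum _ fun i _ => hS2 l i]
    rw [Finset.sum_congr rfl fun i _ => (lintegral_dataLaw_coord μ v n β l i (hS1 l)).trans
      (lintegral_obsLaw_inner_sq (hμ l) (v l) (β l)), ENNReal.ofReal_mul (by positivity)]
    simp
  have key := withDensity_le_of_sq_le (dataLaw μ v n fun _ => (0 : H)) (L := fun d => ∏ l, ∏ i,
      ENNReal.ofReal (Real.exp (⟪(d l i).1, emb (β l)⟫ * (d l i).2 / v l
        - ⟪(d l i).1, emb (β l)⟫ ^ 2 / (2 * v l)))) hG hS (t := t) ?_ hGint.le hA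
  · rw [← dataLaw_eq_withDensity μ hv n β] at key
    refine key.trans ?_
    gcongr
    -- Markov's inequality for S under the law with slopes β; only second moments of the covariates
    -- enter.
    rw [ENNReal.ofReal_div_of_pos ht, ← hSint]
    refine le_trans (measure_mono ?_) (meas_ge_le_lintegral_div
      hS.aemeasurable (by simpa using ht) ENNReal.ofReal_ne_top)
    intro d hd
    simp only [Set.mem_ofPred_eq] at hd ⊢
    exact hd.le
  · intro d hd
    have hSd : S d = ENNReal.ofReal (∑ l, ∑ i, ⟪(d l i).1, emb (β l)⟫ ^ 2 / v l) := by
      rw [ENNReal.ofReal_sum_of_nonneg fun l _ => Finset.sum_nonneg fun i _ => by positivity]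
      exact Finset.sum_congr rfl fun l _ =>
        (ENNReal.ofReal_sum_of_nonneg fun i _ => by positivity).symm
    rw [hSd, ENNReal.ofReal_le_ofReal_iff ht.le] at hd
    have hprod : (∏ l, ∏ i, ENNReal.ofReal (Real.exp (⟪(d l i).1, emb (β l)⟫ * (d l i).2 / v l
        - ⟪(d l i).1, emb (β l)⟫ ^ 2 / (2 * v l)))) ^ 2
        = ENNReal.ofReal (Real.exp (∑ l, ∑ i, ⟪(d l i).1, emb (β l)⟫ ^ 2 / v l)) * G d := by
      rw [Real.exp_sum, ENNReal.ofReal_prod_of_nonneg fun _ _ => Real.exp_nonneg _,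
        ← Finset.prod_mul_distrib, ← Finset.prod_pow]
      refine Finset.prod_congr rfl fun l _ => ?_
      rw [Real.exp_sum, ENNReal.ofReal_prod_of_nonneg fun _ _ => Real.exp_nonneg _,
        ← Finset.prod_mul_distrib, ← Finset.prod_pow]
      refine Finset.prod_congr rfl fun i _ => ?_
      rw [← ENNReal.ofReal_pow (Real.exp_nonneg _), ← ENNReal.ofReal_mul (Real.exp_nonneg _),
        ← Real.exp_add, ← Real.exp_nat_mul]
      have hv' : (v l : ℝ) ≠ 0 := by exact_mod_cast (hv l).ne'
      congr 2
      push_cast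
      field_simp
      ring
    rw [hprod]
    gcongr

end Model

/-! ### Non-asymptotic lower bound -/

section LinearAlgebra

/-- By rank and nullity, `q` spare dimensions pay for `q` linear constraints. -/
theorem exists_orthonormal_ker {D q : ℕ} (Λ : EuclideanSpace ℝ (Fin (D + q)) →ₗ[ℝ] (Fin q → ℝ)) :
    ∃ u : Fin D → EuclideanSpace ℝ (Fin (D + q)), Orthonormal ℝ u ∧ ∀ k, Λ (u k) = 0 := by
  have hdim : D ≤ Module.finrank ℝ (LinearMap.ker Λ) := by
    have h1 := Λ.finrank_range_add_finrank_ker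
    have h2 := Submodule.finrank_le (LinearMap.range Λ)
    rw [finrank_euclideanSpace_fin] at h1
    rw [Module.finrank_fin_fun] at h2
    omega
  have b := stdOrthonormalBasis ℝ (LinearMap.ker Λ)
  refine ⟨fun k => (b (Fin.castLE hdim k) : EuclideanSpace ℝ (Fin (D + q))), ?_, fun k => ?_⟩
  · exact (b.orthonormal.comp_linearIsometry (LinearMap.ker Λ).subtypeₗᵢ).comp _
      (Fin.castLE_injective hdim)
  · exact (b (Fin.castLE hdim k)).2

/-- The combination `∑ u_i e_i` of a finite family, as a linear map of the coefficients. -/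
def combination {E : Type*} [AddCommGroup E] [Module ℝ E] {p : ℕ} (e : Fin p → E) :
    EuclideanSpace ℝ (Fin p) →ₗ[ℝ] E where
  toFun u := ∑ i, u i • e i
  map_add' u w := by simp [add_smul, Finset.sum_add_distrib]
  map_smul' c u := by simp [mul_smul, Finset.smul_sum]

theorem combination_apply {E : Type*} [AddCommGroup E] [Module ℝ E] {p : ℕ} (e : Fin p → E)
    (u : EuclideanSpace ℝ (Fin p)) : combination e u = ∑ i, u i • e i := rfl

theorem norm_combination {E : Type*} [NormedAddCommGroup E] [InnerProductSpace ℝ E] {p : ℕ}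
    {e : Fin p → E} (he : Orthonormal ℝ e) (u : EuclideanSpace ℝ (Fin p)) :
    ‖combination e u‖ = ‖u‖ := by
  have h : ‖combination e u‖ ^ 2 = ‖u‖ ^ 2 := by
    rw [← real_inner_self_eq_norm_sq, combination_apply, he.inner_sum, EuclideanSpace.norm_sq_eq]
    simp [sq]
  exact (pow_left_inj₀ (norm_nonneg _) (norm_nonneg _) two_ne_zero).mp h

theorem inner_sum_sgn_smul {E : Type*} [NormedAddCommGroup E] [InnerProductSpace ℝ E] {D : ℕ}
    {u : Fin D → E} (hu : Orthonormal ℝ u) (ω ω' : Fin D → Bool) :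
    ⟪∑ k, sgn (ω k) • u k, ∑ k, sgn (ω' k) • u k⟫ = ∑ k, sgn (ω k) * sgn (ω' k) := by
  rw [hu.inner_sum]
  simp

theorem norm_sq_sum_sgn_smul {E : Type*} [NormedAddCommGroup E] [InnerProductSpace ℝ E] {D : ℕ}
    {u : Fin D → E} (hu : Orthonormal ℝ u) (ω : Fin D → Bool) :
    ‖∑ k, sgn (ω k) • u k‖ ^ 2 = D := by
  rw [← real_inner_self_eq_norm_sq, inner_sum_sgn_smul hu]
  simp [sgn_mul_self]

theorem norm_sq_sub_sum_sgn_smul {E : Type*} [NormedAddCommGroup E] [InnerProductSpace ℝ E]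
    {D : ℕ} {u : Fin D → E} (hu : Orthonormal ℝ u) (ω ω' : Fin D → Bool) :
    ‖∑ k, sgn (ω k) • u k - ∑ k, sgn (ω' k) • u k‖ ^ 2
      = 2 * D - 2 * ∑ k, sgn (ω k) * sgn (ω' k) := by
  rw [norm_sub_sq_real, norm_sq_sum_sgn_smul hu, norm_sq_sum_sgn_smul hu, inner_sum_sgn_smul hu]
  ring

end LinearAlgebra

/-! ### Second moments, the sign average and the excess risk -/

section Risk

variable {𝒯 : Set ℝ}

/-- Bessel's inequality for the trace of a covariance operator. -/
theorem sum_inner_covOp_combination_le {μ : Measure (L2 𝒯)} [IsProbabilityMeasure μ]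
    (hμ : MemLp id 2 μ) {D p : ℕ} {u : Fin D → EuclideanSpace ℝ (Fin p)} (hu : Orthonormal ℝ u)
    (f : Fin p → L2 𝒯) :
    ∑ k, ⟪covOp μ (combination f (u k)), combination f (u k)⟫ ≤ ∑ i, ⟪covOp μ (f i), f i⟫ := by
  have hint : ∀ g : L2 𝒯, Integrable (fun z => ⟪g, z - μ[id]⟫ * ⟪g, z - μ[id]⟫) μ := by
    intro g
    have h1 : MemLp (fun z : L2 𝒯 => z - μ[id]) 2 μ := hμ.sub (memLp_const _)
    have h2 : MemLp (fun z : L2 𝒯 => ⟪g, z - μ[id]⟫) 2 μ := h1.const_inner g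
    simpa [sq] using h2.integrable_sq
  simp_rw [inner_covOp hμ]
  rw [← integral_finsetSum _ fun k _ => hint _, ← integral_finsetSum _ fun i _ => hint _]
  refine integral_mono (integrable_finsetSum _ fun k _ => hint _)
    (integrable_finsetSum _ fun i _ => hint _) fun z => ?_
  let a : EuclideanSpace ℝ (Fin p) := WithLp.toLp 2 fun i => ⟪f i, z - μ[id]⟫
  have h1 : ∀ k, ⟪combination f (u k), z - μ[id]⟫ = ⟪u k, a⟫ := by
    intro k
    rw [combination_apply, sum_inner, PiLp.inner_apply]
    refine Finset.sum_congr rfl fun i _ => ?_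
    simp [a, inner_smul_left, mul_comm]
  have h2 := hu.sum_inner_products_le a (s := Finset.univ)
  rw [EuclideanSpace.norm_sq_eq] at h2
  simp only [h1]
  simpa [sq, a] using h2

theorem sum_sign_integral_sq {μ : Measure (L2 𝒯)} (hμ : MemLp id 2 μ) {D : ℕ} (c : ℝ)
    (f : Fin D → L2 𝒯) :
    ∑ ω : Fin D → Bool, ∫ x, ⟪x, c • ∑ k, sgn (ω k) • f k⟫ ^ 2 ∂μ
      = 2 ^ D * (c ^ 2 * ∑ k, ∫ x, ⟪x, f k⟫ ^ 2 ∂μ) := by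
  rw [← integral_finsetSum _ fun ω _ => integrable_inner_sq hμ _,
    ← integral_finsetSum _ fun k _ => integrable_inner_sq hμ _, ← integral_const_mul,
    ← integral_const_mul]
  refine integral_congr_ae (ae_of_all _ fun x => ?_)
  have h : ∀ ω : Fin D → Bool, ⟪x, c • ∑ k, sgn (ω k) • f k⟫ ^ 2
      = c ^ 2 * (∑ k, sgn (ω k) * ⟪x, f k⟫) ^ 2 := by
    intro ω
    rw [inner_smul_right, inner_sum, mul_pow]
    simp_rw [inner_smul_right]
  simp_rw [h, ← Finset.mul_sum, sum_sq_sum_sgn, Fintype.card_fin]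
  ring

variable [CompactSpace 𝒯]
variable {H : Type*} [NormedAddCommGroup H] [InnerProductSpace ℝ H] [CompleteSpace H]
  [RKHS ℝ H 𝒯 ℝ] [ContinuousKernel H]

theorem excessRisk_eq {μ : Measure (L2 𝒯)} (g : L2 𝒯) (β : H) :
    excessRisk μ g β = ∫ x, ⟪x, g - emb β⟫ ^ 2 ∂μ := by
  simp_rw [excessRisk, inner_sub_right]

theorem continuous_excessRisk {μ : Measure (L2 𝒯)} [IsProbabilityMeasure μ] (hμ : MemLp id 2 μ)
    (β : H) : Continuous fun g => excessRisk μ g β := by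
  have h : ∀ g, excessRisk μ g β
      = ⟪covOp μ (g - emb β), g - emb β⟫ + ⟪μ[id], g - emb β⟫ ^ 2 := by
    intro g
    rw [excessRisk_eq, inner_covOp_self_eq_sub hμ]
    ring
  simp_rw [h]
  have h1 : Continuous fun g : L2 𝒯 => g - emb β := continuous_id.sub continuous_const
  exact (((covOp μ).continuous.comp h1).inner h1).add ((continuous_const.inner h1).pow 2)

/-- Centring only lowers the second moment, and (a - b)² ≤ 2a² + 2b². -/
theorem inner_covOp_sub_le {μ : Measure (L2 𝒯)} [IsProbabilityMeasure μ] (hμ : MemLp id 2 μ)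
    (g : L2 𝒯) (β β' : H) :
    ⟪covOp μ (emb (β - β')), emb (β - β')⟫ ≤ 2 * excessRisk μ g β + 2 * excessRisk μ g β' := by
  rw [inner_covOp_self_eq_sub hμ, excessRisk_eq, excessRisk_eq, ← integral_const_mul,
    ← integral_const_mul, ← integral_add ((integrable_inner_sq hμ _).const_mul 2)
    ((integrable_inner_sq hμ _).const_mul 2)]
  refine (sub_le_self _ (sq_nonneg _)).trans ?_
  refine integral_mono (integrable_inner_sq hμ _)
    (((integrable_inner_sq hμ _).const_mul 2).add ((integrable_inner_sq hμ _).const_mul 2)) ?_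
  intro x
  have h : emb (β - β') = (g - emb β') - (g - emb β) := by
    rw [← embCLM_apply, map_sub, embCLM_apply, embCLM_apply]
    abel
  simp only [h, inner_sub_right]
  nlinarith [sq_nonneg ((⟪x, g⟫ - ⟪x, emb β'⟫) + (⟪x, g⟫ - ⟪x, emb β⟫))]

end Risk

/-! ### The sign family of slopes -/

section LowerBound

variable {𝒯 : Set ℝ} [CompactSpace 𝒯]
variable {H : Type*} [NormedAddCommGroup H] [InnerProductSpace ℝ H] [CompleteSpace H]
  [RKHS ℝ H 𝒯 ℝ] [ContinuousKernel H]

theorem exists_slope_dataLaw_le {m : ℕ} {μ : Fin (m + 1) → Measure (L2 𝒯)}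
    [∀ l, IsProbabilityMeasure (μ l)] (hμ : ∀ l, MemLp id 2 (μ l))
    {v : Fin (m + 1) → ℝ≥0} (hv : ∀ l, 0 < v l) {s : ℕ → ℝ} {φ : ℕ → L2 𝒯}
    (hs : IsEigenSystem (opT H (μ 0)) s φ) (hpos : ∀ j, 0 < s j)
    (hK : (sqrtK H).IsPositive ∧ sqrtK H ∘L sqrtK H = integralOp (kern H))
    {n : Fin (m + 1) → ℕ} (hn : 0 < n 0) {D : ℕ} (hD : 0 < D) {τ : ℝ}
    (hτ : ∀ j, D ≤ j → ∀ l, ⟪opT H (μ l) (φ j), φ j⟫ ≤ τ) {R : ℝ} (hR : 0 < R)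
    {est : Data 𝒯 n → L2 𝒯} (hest : Measurable est) :
    ∃ β : H, ‖β‖ = R ∧ IsPooledSlope μ n (fun _ => β) β ∧
      dataLaw μ v n (fun _ => β)
        {d | excessRisk (μ 0) (est d) β < s (2 * D + m) * R ^ 2 / 8} ≤
      ENNReal.ofReal ((∑ l, n l / (v l : ℝ)) * (R ^ 2 / D * ((D + (m + 1) : ℕ) * τ)) / (D / 16)
        + 2 * Real.exp (-(D / 16))) := by
  obtain ⟨e, he, hemb, hker⟩ := exists_orthonormal_emb_eq hK μ hs hpos
  -- Starting at index D keeps every diagonal below τ; the m + 1 extra directions are spent on the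
  -- means of the m + 1 covariate laws.
  let eb : Fin (D + (m + 1)) → H := fun i => e (D + i)
  let φb : Fin (D + (m + 1)) → L2 𝒯 := fun i => φ (D + i)
  have hinj : Function.Injective fun i : Fin (D + (m + 1)) => D + (i : ℕ) := fun i j hij =>
    Fin.ext (Nat.add_left_cancel hij)
  have heb : Orthonormal ℝ eb := he.comp _ hinj
  have hφb : Orthonormal ℝ φb := hs.orthonormal.comp _ hinj
  -- On the kernel of Λ the mean terms vanish, so second moments are covariance forms in every task.
  let Λ : EuclideanSpace ℝ (Fin (D + (m + 1))) →ₗ[ℝ] (Fin (m + 1) → ℝ) :=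
    LinearMap.pi fun l => (innerₛₗ ℝ ((μ l)[id])) ∘ₗ (embCLM H).toLinearMap ∘ₗ combination eb
  obtain ⟨u, hu, hΛ⟩ := exists_orthonormal_ker Λ
  have hmean : ∀ l k, ⟪(μ l)[id], emb (combination eb (u k))⟫ = 0 := fun l k =>
    congrFun (hΛ k) l
  have hembc : ∀ w, emb (combination eb w) = combination (fun i => emb (eb i)) w := by
    intro w
    rw [← embCLM_apply, combination_apply, combination_apply, map_sum]
    exact Finset.sum_congr rfl fun i _ => map_smul _ _ _
  have hembφ : ∀ w, emb (combination eb w) = sqrtK H (combination φb w) := by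
    intro w
    rw [hembc, combination_apply, combination_apply, map_sum]
    refine Finset.sum_congr rfl fun i _ => ?_
    rw [map_smul, hemb]
  set c : ℝ := R / √D with hc
  have hD' : (0 : ℝ) < D := by exact_mod_cast hD
  have hc2 : c ^ 2 = R ^ 2 / D := by rw [hc, div_pow, Real.sq_sqrt hD'.le]
  let U : (Fin D → Bool) → EuclideanSpace ℝ (Fin (D + (m + 1))) :=
    fun ω => c • ∑ k, sgn (ω k) • u k
  let β : (Fin D → Bool) → H := fun ω => combination eb (U ω)
  have hnorm : ∀ ω, ‖β ω‖ = R := by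
    intro ω
    have h : ‖β ω‖ ^ 2 = R ^ 2 := by
      simp only [β, U]
      rw [norm_combination heb, norm_smul, mul_pow, norm_sq_sum_sgn_smul hu, Real.norm_eq_abs,
        sq_abs, hc2]
      field_simp
    exact (pow_left_inj₀ (norm_nonneg _) hR.le two_ne_zero).mp h
  have hβemb : ∀ ω, emb (β ω) = c • ∑ k, sgn (ω k) • emb (combination eb (u k)) := by
    intro ω
    simp only [β, U, ← embCLM_apply, map_smul, map_sum]
  have hpool : ∀ ω, IsPooledSlope μ n (fun _ => β ω) (β ω) := by
    intro ω
    refine isPooledSlope_const fun b hb => ?_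
    have h := hker (weight n) (fun l => by unfold weight; positivity)
      (by unfold weight; positivity) b hb
    simp only [β]
    rw [combination_apply, sum_inner]
    refine Finset.sum_eq_zero fun i _ => ?_
    rw [inner_smul_left, h, mul_zero]
  have hlow : ∀ w, s (2 * D + m) * ‖w‖ ^ 2
      ≤ ⟪covOp (μ 0) (emb (combination eb w)), emb (combination eb w)⟫ := by
    intro w
    rw [hembφ, ← inner_opT hK, combination_apply, map_sum]
    have h1 : ∀ i, opT H (μ 0) (w i • φb i) = (s (D + i) * w i) • φb i := by
      intro i
      rw [map_smul, hs.eigen, smul_smul, mul_comm]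
    simp_rw [h1]
    rw [hφb.inner_sum, EuclideanSpace.norm_sq_eq, Finset.mul_sum]
    refine Finset.sum_le_sum fun i _ => ?_
    have h2 : s (2 * D + m) ≤ s (D + i) := hs.antitone (by have := i.2; omega)
    simp only [conj_trivial, Real.norm_eq_abs, sq_abs]
    nlinarith [mul_le_mul_of_nonneg_right h2 (sq_nonneg (w i))]
  have hup : ∀ l, ∑ ω, ∫ x, ⟪x, emb (β ω)⟫ ^ 2 ∂(μ l)
      ≤ 2 ^ D * (R ^ 2 / D * ((D + (m + 1) : ℕ) * τ)) := by
    intro l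
    simp_rw [hβemb]
    rw [sum_sign_integral_sq (hμ l), hc2]
    gcongr
    calc ∑ k, ∫ x, ⟪x, emb (combination eb (u k))⟫ ^ 2 ∂(μ l)
        = ∑ k, ⟪covOp (μ l) (combination (fun i => emb (eb i)) (u k)),
            combination (fun i => emb (eb i)) (u k)⟫ := by
          refine Finset.sum_congr rfl fun k _ => ?_
          rw [← hembc, inner_covOp_self_eq_sub (hμ l), hmean]
          ring
      _ ≤ ∑ i, ⟪covOp (μ l) (emb (eb i)), emb (eb i)⟫ :=
          sum_inner_covOp_combination_le (hμ l) hu _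
      _ ≤ ∑ _i : Fin (D + (m + 1)), τ := by
          refine Finset.sum_le_sum fun i _ => ?_
          rw [hemb, ← inner_opT hK]
          exact hτ _ (Nat.le_add_right _ _) l
      _ = _ := by simp
  set δ := s (2 * D + m) * R ^ 2 / 8 with hδ
  have key := exists_sign_measure_le (fun ω => dataLaw μ v n fun _ => β ω)
    (dataLaw μ v n fun _ => (0 : H)) (A := fun ω => {d | excessRisk (μ 0) (est d) (β ω) < δ})
    (fun ω => ((continuous_excessRisk (hμ 0) (β ω)).measurable.comp hest) measurableSet_Iio)
    ?_ (B := fun ω => (∑ l, n l * ((∫ x, ⟪x, emb (β ω)⟫ ^ 2 ∂(μ l)) / v l)) / (D / 16))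
    (fun ω => by positivity)
    (η := (∑ l, n l / (v l : ℝ)) * (R ^ 2 / D * ((D + (m + 1) : ℕ) * τ)) / (D / 16)) ?_
    (fun ω => dataLaw_le hμ hv n _
      (((continuous_excessRisk (hμ 0) (β ω)).measurable.comp hest) measurableSet_Iio)
      (by positivity))
  · obtain ⟨ω, hω⟩ := key
    exact ⟨β ω, hnorm ω, hpool ω, hω⟩
  · intro d ω ω' hω hω'
    have h1 := inner_covOp_sub_le (hμ 0) (est d) (β ω) (β ω')
    have h2 : β ω - β ω' = combination eb (U ω - U ω') := (map_sub _ _ _).symm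
    rw [h2] at h1
    have h3 := hlow (U ω - U ω')
    have h4 : ‖U ω - U ω'‖ ^ 2 = R ^ 2 / D * (2 * D - 2 * ∑ k, sgn (ω k) * sgn (ω' k)) := by
      simp only [U]
      rw [← smul_sub, norm_smul, mul_pow, norm_sq_sub_sum_sgn_smul hu, Real.norm_eq_abs, sq_abs,
        hc2]
    have h5 : s (2 * D + m) * (R ^ 2 / D * (2 * D - 2 * ∑ k, sgn (ω k) * sgn (ω' k)))
        < 4 * δ := by
      rw [← h4]
      have hω1 : excessRisk (μ 0) (est d) (β ω) < δ := hω
      have hω2 : excessRisk (μ 0) (est d) (β ω') < δ := hω'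
      linarith
    -- The divisor 8 in δ is chosen for this: 2D - 2⟨ω, ω'⟩ < D/2 means a correlation above 3D/4.
    have h6 : 4 * δ = s (2 * D + m) * (R ^ 2 / D * (D / 2)) := by
      rw [hδ]
      field_simp
      ring
    rw [h6] at h5
    have h7 := lt_of_mul_lt_mul_left h5 (hpos _).le
    have h8 := lt_of_mul_lt_mul_left h7 (by positivity)
    linarith
  · rw [← Finset.sum_div, Finset.sum_comm, ← mul_div_assoc]
    gcongr
    rw [mul_left_comm, Finset.sum_mul]
    refine Finset.sum_le_sum fun l _ => ?_
    rw [← Finset.mul_sum, ← Finset.sum_div, div_mul_eq_mul_div, mul_div_assoc]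
    gcongr
    exact hup l

end LowerBound

/-! ### Asymptotics -/

section Asymptotics

variable {𝒯 : Set ℝ} [CompactSpace 𝒯] {m : ℕ}

theorem sum_div_le_mul_total (n : Fin (m + 1) → ℕ) (v : Fin (m + 1) → ℝ≥0) :
    ∑ l, n l / (v l : ℝ) ≤ (∑ l, 1 / (v l : ℝ)) * ((nS n + n 0 : ℕ) : ℝ) := by
  rw [Finset.sum_mul]
  refine Finset.sum_le_sum fun l _ => ?_
  rw [div_eq_mul_one_div, mul_comm]
  gcongr
  have h : nS n + n 0 = ∑ l, n l := by rw [Fin.sum_univ_succ, nS, add_comm]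
  rw [h]
  exact Finset.single_le_sum (f := n) (fun _ _ => Nat.zero_le _) (Finset.mem_univ l)

theorem sum_information_le (n : Fin (m + 1) → ℕ) (v : Fin (m + 1) → ℝ≥0) {R τ : ℝ} (hτ : 0 ≤ τ)
    {D : ℕ} (hD : 0 < D) :
    (∑ l, n l / (v l : ℝ)) * (R ^ 2 / D * ((D + (m + 1) : ℕ) * τ)) / (D / 16)
      ≤ (∑ l, 1 / (v l : ℝ)) * ((nS n + n 0 : ℕ) : ℝ) * (R ^ 2 / D * ((m + 2) * D * τ))
        / (D / 16) := by
  have h1 : ((D + (m + 1) : ℕ) : ℝ) ≤ (m + 2) * D := by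
    have h5 : (1 : ℝ) ≤ D := by exact_mod_cast hD
    have h6 : (0 : ℝ) ≤ m := by positivity
    push_cast
    nlinarith
  have h2 := sum_div_le_mul_total n v
  gcongr

theorem eigenvalue_ge {r c X sD : ℝ} (hr : 0 < r) (hc : 0 < c) {D : ℕ} (hD : 0 < D)
    (hDX : (D : ℝ) ≤ 2 * X) (h : ((2 * D + m : ℕ) : ℝ) ^ (-(2 * r)) ≤ c * sD) :
    c⁻¹ * (2 * (m + 2)) ^ (-(2 * r)) * X ^ (-(2 * r)) ≤ sD := by
  have h5 : (1 : ℝ) ≤ D := by exact_mod_cast hD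
  have h6 : (0 : ℝ) ≤ m := by positivity
  have h4 : (2 * (m + 2) * X) ^ (-(2 * r)) ≤ ((2 * D + m : ℕ) : ℝ) ^ (-(2 * r)) := by
    refine Real.rpow_le_rpow_of_nonpos (by positivity) ?_ (by linarith)
    push_cast
    nlinarith
  rw [Real.mul_rpow (by positivity) (by linarith)] at h4
  rw [mul_assoc, ← div_eq_inv_mul, div_le_iff₀ hc, mul_comm sD]
  exact h4.trans h

theorem le_ceil_rpow {r y : ℝ} (hr : 0 < r) (hy : 0 ≤ y) :
    y ≤ (⌈y ^ (1 / (2 * r + 1))⌉₊ : ℝ) ^ (2 * r + 1) := by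
  have h1 : y = (y ^ (1 / (2 * r + 1))) ^ (2 * r + 1) := by
    rw [← Real.rpow_mul hy, one_div, inv_mul_cancel₀ (by positivity), Real.rpow_one]
  calc y = _ := h1
    _ ≤ _ := Real.rpow_le_rpow (by positivity) (Nat.le_ceil _) (by positivity)

/-- With τ = C D^{-2r} the information divided by D/16 is K R² N / D^{2r+1}, and D was chosen to
make this at most K/B. -/
theorem information_le {r K N R B D : ℝ} (hK : 0 ≤ K) (hB : 0 < B) (hD : 0 < D)
    (h : B * R ^ 2 * N ≤ D ^ (2 * r + 1)) {V C q : ℝ} (hKdef : K = 16 * V * q * C) :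
    V * N * (R ^ 2 / D * (q * D * (C * D ^ (-(2 * r))))) / (D / 16) ≤ K / B := by
  have h1 : D ^ (-(2 * r)) = D / D ^ (2 * r + 1) := by
    rw [Real.rpow_add_one hD.ne', Real.rpow_neg hD.le]
    field_simp
  have hDp : 0 < D ^ (2 * r + 1) := Real.rpow_pos_of_pos hD _
  have h2 : V * N * (R ^ 2 / D * (q * D * (C * D ^ (-(2 * r))))) / (D / 16)
      = K * (R ^ 2 * N / D ^ (2 * r + 1)) := by
    rw [h1, hKdef]
    field_simp
  rw [h2, div_eq_mul_inv K]
  gcongr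
  rw [div_le_iff₀ hDp, ← div_eq_inv_mul, le_div_iff₀ hB]
  linarith

/-- Substituting X leaves (R²)^{1/(2r+1)} N^{-2r/(2r+1)} up to a power of B. The power of R is
positive, so a lower bound on R suffices and R may grow with the sample sizes. -/
theorem separation_ge {r B R R₀ N y X : ℝ} (hr : 0 < r) (hB : 0 < B) (hR₀ : 0 < R₀)
    (hR : R₀ ≤ R) (hN : 0 < N) (hy : y = B * R ^ 2 * N) (hX : X = y ^ (1 / (2 * r + 1))) :
    B ^ (-(2 * r) / (2 * r + 1)) * (R₀ ^ 2) ^ (1 / (2 * r + 1)) * N ^ (-(2 * r) / (2 * r + 1))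
      ≤ X ^ (-(2 * r)) * R ^ 2 := by
  have hRp : 0 < R := hR₀.trans_le hR
  have h1 : X ^ (-(2 * r)) = y ^ (-(2 * r) / (2 * r + 1)) := by
    rw [hX, ← Real.rpow_mul (by rw [hy]; positivity)]
    congr 1
    ring
  have h2 : (R ^ 2) ^ (-(2 * r) / (2 * r + 1)) * R ^ 2 = (R ^ 2) ^ (1 / (2 * r + 1)) := by
    rw [← Real.rpow_add_one (by positivity)]
    congr 1
    field_simp
    ring
  have h3 : X ^ (-(2 * r)) * R ^ 2 = B ^ (-(2 * r) / (2 * r + 1)) * (R ^ 2) ^ (1 / (2 * r + 1))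
      * N ^ (-(2 * r) / (2 * r + 1)) := by
    rw [h1, hy, Real.mul_rpow (by positivity) hN.le, Real.mul_rpow hB.le (by positivity), ← h2]
    ring
  rw [h3]
  gcongr

variable {H : Type*} [NormedAddCommGroup H] [InnerProductSpace ℝ H] [CompleteSpace H]
  [RKHS ℝ H 𝒯 ℝ] [ContinuousKernel H]

theorem minimaxProb_le_one (μ : Fin (m + 1) → Measure (L2 𝒯)) [∀ l, IsProbabilityMeasure (μ l)]
    (v : Fin (m + 1) → ℝ≥0) (r h : ℝ) (A : Set ℝ) (n : Fin (m + 1) → ℕ) (a : ℝ) :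
    minimaxProb H μ v r h A n a ≤ 1 :=
  (iInf₂_le (fun _ => (0 : L2 𝒯)) measurable_const).trans
    (iSup_le fun _ => iSup_le fun _ => iSup_le fun _ => iSup_le fun _ => iSup_le fun _ =>
      prob_le_one)

theorem ofReal_le_minimaxProb {μ : Fin (m + 1) → Measure (L2 𝒯)}
    [∀ l, IsProbabilityMeasure (μ l)] (hμ : ∀ l, MemLp id 2 (μ l)) {v : Fin (m + 1) → ℝ≥0}
    {r h : ℝ} (hh : 0 ≤ h) {A : Set ℝ} {n : Fin (m + 1) → ℕ} {a R δ ε : ℝ} (hRA : R ∈ A)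
    (hδ : a * rate r h R n ≤ δ) (hε : 0 ≤ ε)
    (hβ : ∀ est : Data 𝒯 n → L2 𝒯, Measurable est →
      ∃ β : H, ‖β‖ = R ∧ IsPooledSlope μ n (fun _ => β) β ∧
        dataLaw μ v n (fun _ => β) {d | excessRisk (μ 0) (est d) β < δ} ≤ ENNReal.ofReal ε) :
    ENNReal.ofReal (1 - ε) ≤ minimaxProb H μ v r h A n a := by
  refine le_iInf₂ fun est hest => ?_
  obtain ⟨β, hβR, hpool, hle⟩ := hβ est hest
  refine le_trans ?_ (le_iSup_of_le (fun _ => β) (le_iSup_of_le β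
    (le_iSup_of_le (fun l => by simpa using hh) (le_iSup_of_le hpool
      (le_iSup_of_le (by rwa [hβR]) le_rfl)))))
  have hm : MeasurableSet {d | excessRisk (μ 0) (est d) β < δ} :=
    ((continuous_excessRisk (hμ 0) β).measurable.comp hest) measurableSet_Iio
  calc ENNReal.ofReal (1 - ε) = 1 - ENNReal.ofReal ε := by
        rw [ENNReal.ofReal_sub _ hε, ENNReal.ofReal_one]
    _ ≤ 1 - dataLaw μ v n (fun _ => β) {d | excessRisk (μ 0) (est d) β < δ} := by gcongr
    _ = dataLaw μ v n (fun _ => β) {d | excessRisk (μ 0) (est d) β < δ}ᶜ :=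
        (prob_compl_eq_one_sub hm).symm
    _ ≤ _ := by
        refine measure_mono fun d hd => ?_
        have hd' : δ ≤ excessRisk (μ 0) (est d) β := not_lt.mp hd
        rw [hβR]
        exact hδ.trans hd'

theorem tendsto_liminf_minimaxProb {μ : Fin (m + 1) → Measure (L2 𝒯)}
    [∀ l, IsProbabilityMeasure (μ l)] (hμ : ∀ l, MemLp id 2 (μ l))
    {v : Fin (m + 1) → ℝ≥0} (hv : ∀ l, 0 < v l)
    {s : ℕ → ℝ} {φ : ℕ → L2 𝒯} (hs : IsEigenSystem (opT H (μ 0)) s φ)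
    {r : ℝ} (hr : 0 < r) (hdecay : s =Θ[atTop] fun j : ℕ => (j : ℝ) ^ (-(2 * r)))
    (hT : CommuteCondition (fun l => opT H (μ l)) s φ ∨ HSCondition (fun l => opT H (μ l)))
    {h : ℝ} (hh : 0 ≤ h) {n : ℕ → Fin (m + 1) → ℕ}
    (hn0 : Tendsto (fun k => n k 0) atTop atTop) {A : Set ℝ} {R : ℕ → ℝ} (hRA : ∀ k, R k ∈ A)
    {R₀ : ℝ} (hR₀ : 0 < R₀) (hR : ∀ k, R₀ ≤ R k) {C₁ : ℝ}
    (hrate : ∀ᶠ k in atTop, rate r h (R k) (n k)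
      ≤ C₁ * ((nS (n k) + n k 0 : ℕ) : ℝ) ^ (-(2 * r) / (2 * r + 1))) :
    Tendsto (fun a => liminf (fun k => minimaxProb H μ v r h A (n k) a) atTop)
      (𝓝[>] 0) (𝓝 1) := by
  have hK := sqrtK_spec hs hdecay
  have hpos := eigenvalue_pos hs.antitone hdecay (eigenvalue_nonneg hK hs)
  obtain ⟨C, hC, hCev⟩ := exists_diagonal_le hK hs hdecay hT
  obtain ⟨J, hJ⟩ := eventually_atTop.mp hCev
  obtain ⟨c, hc, hcev⟩ := hdecay.2.exists_pos
  obtain ⟨J', hJ'⟩ := eventually_atTop.mp hcev.bound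
  have hN : Tendsto (fun k => ((nS (n k) + n k 0 : ℕ) : ℝ)) atTop atTop :=
    tendsto_natCast_atTop_atTop.comp
      (tendsto_atTop_mono (fun k => Nat.le_add_left (n k 0) (nS (n k))) hn0)
  set V : ℝ := ∑ l, 1 / (v l : ℝ) with hV
  have hVpos : 0 < V := Finset.sum_pos (fun l _ => by have := hv l; positivity)
    Finset.univ_nonempty
  rw [tendsto_order]
  refine ⟨fun b hb => ?_, fun b hb => Eventually.of_forall fun a => lt_of_le_of_lt ?_ hb⟩
  swap
  · calc liminf (fun k => minimaxProb H μ v r h A (n k) a) atTop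
        ≤ liminf (fun _ : ℕ => (1 : ℝ≥0∞)) atTop :=
          liminf_le_liminf (Eventually.of_forall fun k => minimaxProb_le_one μ v r h A (n k) a)
      _ = 1 := by simp
  obtain ⟨p, hp0, hbp, hp1⟩ := ENNReal.lt_iff_exists_real_btwn.mp hb
  have hp1' : p < 1 := by simpa using hp1
  set ε := 1 - p with hε
  have hεpos : 0 < ε := by linarith
  set K : ℝ := 16 * V * (m + 2) * C with hKdef
  have hKpos : 0 < K := by positivity
  -- This makes the information bound K/B equal to ε/2; the exponential remainder takes the other
  -- half.
  set B : ℝ := 2 * K / ε with hBdef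
  have hB : 0 < B := by positivity
  set c₃ : ℝ := c⁻¹ * (2 * (m + 2)) ^ (-(2 * r))
    * (B ^ (-(2 * r) / (2 * r + 1)) * (R₀ ^ 2) ^ (1 / (2 * r + 1))) / 8 with hc₃
  have hc₃pos : 0 < c₃ := by positivity
  -- The maximum with 1 keeps the threshold for `a` positive whatever the sign of C₁.
  have hC₁ : 0 < max C₁ 1 := lt_max_of_lt_right one_pos
  have hexp : ∀ᶠ D : ℕ in atTop, 2 * Real.exp (-((D : ℝ) / 16)) ≤ ε / 2 := by
    have h1 : Tendsto (fun D : ℕ => 2 * Real.exp (-((D : ℝ) / 16))) atTop (𝓝 (2 * 0)) :=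
      (Real.tendsto_exp_neg_atTop_nhds_zero.comp
        (tendsto_natCast_atTop_atTop.atTop_div_const (by norm_num))).const_mul 2
    rw [mul_zero] at h1
    exact h1.eventually_le_const (by positivity)
  have hy : Tendsto (fun k => B * R k ^ 2 * ((nS (n k) + n k 0 : ℕ) : ℝ)) atTop atTop := by
    refine tendsto_atTop_mono (fun k => ?_) (hN.const_mul_atTop (show 0 < B * R₀ ^ 2 by positivity))
    gcongr
    exact hR k
  have hX := (tendsto_rpow_atTop (show 0 < 1 / (2 * r + 1) by positivity)).comp hy
  have hDtop := tendsto_nat_ceil_atTop.comp hX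
  have hgood : ∀ a : ℝ, 0 < a → a ≤ c₃ / max C₁ 1 →
      ∀ᶠ k in atTop, ENNReal.ofReal p ≤ minimaxProb H μ v r h A (n k) a := by
    intro a ha ha'
    filter_upwards [hrate, hX.eventually_ge_atTop 1, hN.eventually_gt_atTop 0,
      hn0.eventually_gt_atTop 0, hDtop.eventually hexp, hDtop.eventually_ge_atTop (J + J' + 1)]
      with k hk1 hk2 hk3 hk4 hk5 hk6
    simp only [Function.comp_apply] at hk2 hk5 hk6
    set N : ℝ := ((nS (n k) + n k 0 : ℕ) : ℝ) with hNdef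
    set y := B * R k ^ 2 * N with hydef
    set X := y ^ (1 / (2 * r + 1)) with hXdef
    set D := ⌈X⌉₊ with hDdef
    have hRk : 0 < R k := hR₀.trans_le (hR k)
    have hD : 0 < D := by omega
    have hD' : (0 : ℝ) < D := by exact_mod_cast hD
    have hyD : y ≤ (D : ℝ) ^ (2 * r + 1) := le_ceil_rpow hr (by positivity)
    have hDX : (D : ℝ) ≤ 2 * X := by
      have : (D : ℝ) ≤ X + 1 := (Nat.ceil_lt_add_one (zero_le_one.trans hk2)).le
      linarith
    have hsep : a * rate r h (R k) (n k) ≤ s (2 * D + m) * R k ^ 2 / 8 := by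
      have h1 : a * rate r h (R k) (n k) ≤ c₃ * N ^ (-(2 * r) / (2 * r + 1)) := by
        calc a * rate r h (R k) (n k)
            ≤ a * (max C₁ 1 * N ^ (-(2 * r) / (2 * r + 1))) := by
              refine mul_le_mul_of_nonneg_left (hk1.trans ?_) ha.le
              exact mul_le_mul_of_nonneg_right (le_max_left _ _) (by positivity)
          _ ≤ c₃ / max C₁ 1 * (max C₁ 1 * N ^ (-(2 * r) / (2 * r + 1))) := by
            gcongr
          _ = _ := by field_simp
      have h2 : c⁻¹ * (2 * (m + 2)) ^ (-(2 * r)) * X ^ (-(2 * r)) ≤ s (2 * D + m) := by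
        have h3 := hJ' (2 * D + m) (by omega)
        rw [Real.norm_of_nonneg (by positivity), Real.norm_of_nonneg (hpos _).le] at h3
        exact eigenvalue_ge hr hc hD hDX h3
      have h7 := separation_ge hr hB hR₀ (hR k) hk3 hydef hXdef
      calc _ ≤ _ := h1
        _ = c⁻¹ * (2 * (m + 2)) ^ (-(2 * r)) * (B ^ (-(2 * r) / (2 * r + 1))
            * (R₀ ^ 2) ^ (1 / (2 * r + 1)) * N ^ (-(2 * r) / (2 * r + 1))) / 8 := by
          rw [hc₃]
          ring
        _ ≤ c⁻¹ * (2 * (m + 2)) ^ (-(2 * r)) * (X ^ (-(2 * r)) * R k ^ 2) / 8 := by gcongr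
        _ = c⁻¹ * (2 * (m + 2)) ^ (-(2 * r)) * X ^ (-(2 * r)) * R k ^ 2 / 8 := by ring
        _ ≤ _ := by gcongr
    have hp : p = 1 - ε := by rw [hε]; ring
    rw [hp]
    refine ofReal_le_minimaxProb hμ hh (hRA k) hsep hεpos.le fun est hest => ?_
    obtain ⟨β, hβR, hpool, hle⟩ := exists_slope_dataLaw_le hμ hv hs hpos hK hk4 hD
      (τ := C * (D : ℝ) ^ (-(2 * r))) (fun j hj l => (hJ j (by omega) l).trans
        (mul_le_mul_of_nonneg_left (Real.rpow_le_rpow_of_nonpos hD' (Nat.cast_le.mpr hj)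
          (by linarith)) hC.le)) hRk hest
    refine ⟨β, hβR, hpool, hle.trans (ENNReal.ofReal_le_ofReal ?_)⟩
    have h8 : (∑ l, n k l / (v l : ℝ))
        * (R k ^ 2 / D * ((D + (m + 1) : ℕ) * (C * (D : ℝ) ^ (-(2 * r))))) / (D / 16)
        ≤ ε / 2 := by
      refine (sum_information_le (n k) v (by positivity) hD).trans ?_
      refine (information_le hKpos.le hB hD' hyD hKdef).trans_eq ?_
      rw [hBdef]
      field_simp
    linarith
  have hIoc : Set.Ioc (0 : ℝ) (c₃ / max C₁ 1) ∈ 𝓝[>] (0 : ℝ) :=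
    Ioc_mem_nhdsGT (by positivity)
  filter_upwards [hIoc] with a ha
  exact hbp.trans_le (le_liminf_of_le (by isBoundedDefault) (hgood a ha.1 ha.2))

/-- The condition says (h/R)^{2/(2r+1)} ≤ (n₀/N)^{2r/(2r+1)}, which turns the power of n₀ in the
second term into that of N. -/
theorem rate_le_of_large_radius {r h : ℝ} (hr : 0 < r) (hh : 0 ≤ h) {n : Fin (m + 1) → ℕ}
    (hn : 0 < n 0) {R : ℝ} (hR : 0 < R)
    (hRh : h * (((nS n + n 0 : ℕ) : ℝ) / n 0) ^ r ≤ R) :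
    rate r h R n ≤ 2 * ((nS n + n 0 : ℕ) : ℝ) ^ (-(2 * r) / (2 * r + 1)) := by
  have hn0 : (0 : ℝ) < n 0 := by exact_mod_cast hn
  have hN : (0 : ℝ) < ((nS n + n 0 : ℕ) : ℝ) := by exact_mod_cast (by omega)
  rw [rate]
  set N : ℝ := ((nS n + n 0 : ℕ) : ℝ) with hNdef
  have h1 : h / R ≤ ((n 0 : ℝ) / N) ^ r := by
    rw [div_le_iff₀ hR]
    calc h = ((n 0 : ℝ) / N) ^ r * (h * (N / n 0) ^ r) := by
          rw [mul_left_comm, ← Real.mul_rpow (by positivity) (by positivity),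
            div_mul_div_cancel₀ hN.ne', div_self hn0.ne', Real.one_rpow, mul_one]
      _ ≤ _ := by gcongr
  have h2 : (n 0 : ℝ) ^ (-(2 * r) / (2 * r + 1)) * (h / R) ^ (2 / (2 * r + 1))
      ≤ N ^ (-(2 * r) / (2 * r + 1)) := by
    calc _ ≤ (n 0 : ℝ) ^ (-(2 * r) / (2 * r + 1))
          * (((n 0 : ℝ) / N) ^ r) ^ (2 / (2 * r + 1)) := by gcongr
      _ = N ^ (-(2 * r) / (2 * r + 1)) := by
          have h3 : r * (2 / (2 * r + 1)) = -(-(2 * r) / (2 * r + 1)) := by ring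
          rw [← Real.rpow_mul (by positivity), h3, Real.div_rpow hn0.le hN.le,
            Real.rpow_neg hn0.le, Real.rpow_neg hN.le]
          have h4 : (n 0 : ℝ) ^ (-(2 * r) / (2 * r + 1)) ≠ 0 :=
            (Real.rpow_pos_of_pos hn0 _).ne'
          rw [inv_div_inv, mul_div_cancel₀ _ h4]
  linarith

theorem rate_le_of_comparable {r h : ℝ} (hr : 0 < r) (hh : 0 ≤ h) {n : Fin (m + 1) → ℕ}
    (hn : 0 < n 0) {R : ℝ} (hR : 0 < R) {c : ℝ} (hc : 0 < c) (hnS : (nS n : ℝ) ≤ c * n 0) :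
    rate r h R n ≤ (1 + (c + 1)⁻¹ ^ (-(2 * r) / (2 * r + 1)) * (h / R) ^ (2 / (2 * r + 1)))
      * ((nS n + n 0 : ℕ) : ℝ) ^ (-(2 * r) / (2 * r + 1)) := by
  have hn0 : (0 : ℝ) < n 0 := by exact_mod_cast hn
  have hN : (0 : ℝ) < ((nS n + n 0 : ℕ) : ℝ) := by exact_mod_cast (by omega)
  have hle : (c + 1)⁻¹ * ((nS n + n 0 : ℕ) : ℝ) ≤ n 0 := by
    rw [← div_eq_inv_mul, div_le_iff₀ (by positivity)]
    push_cast
    linarith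
  rw [rate, add_mul, one_mul]
  refine add_le_add le_rfl ?_
  rw [mul_right_comm, ← Real.mul_rpow (by positivity) hN.le]
  refine mul_le_mul_of_nonneg_right (Real.rpow_le_rpow_of_nonpos (by positivity) hle ?_)
    (by positivity)
  rw [neg_div]
  exact neg_nonpos.mpr (by positivity)

end Asymptotics

end FLR

/-! ### The theorem: a growing norm, then a prescribed one -/

open FLR
theorem theorem2
    -- the compact domain and the RKHS
    {𝒯 : Set ℝ} [CompactSpace 𝒯]
    (H : Type*) [NormedAddCommGroup H] [InnerProductSpace ℝ H] [CompleteSpace H]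
    [RKHS ℝ H 𝒯 ℝ] [ContinuousKernel H]
    -- laws of the covariates and noise variances of the target `0` and the `m` sources
    (m : ℕ) (μ : Fin (m + 1) → Measure (L2 𝒯)) [∀ l, IsProbabilityMeasure (μ l)]
    (hμ : ∀ l, MemLp id 2 (μ l))
    (v : Fin (m + 1) → ℝ≥0) (hv : ∀ l, 0 < v l)
    -- eigenvalues and eigenfunctions of the target operator, decay of the eigenvalues
    (s : ℕ → ℝ) (φ : ℕ → L2 𝒯) (hs : IsEigenSystem (opT H (μ 0)) s φ)
    (r : ℝ) (hr : 0 < r) (hdecay : s =Θ[atTop] fun j : ℕ => (j : ℝ) ^ (-(2 * r)))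
    (hT : CommuteCondition (fun l => opT H (μ l)) s φ ∨ HSCondition (fun l => opT H (μ l)))
    (h : ℝ) (hh : 0 ≤ h)
    -- sample sizes along a sequence with `n₀ → ∞` and `n₀ / n_S` not tending to `0`
    (n : ℕ → Fin (m + 1) → ℕ) (hn0 : Tendsto (fun k => n k 0) atTop atTop)
    (hn : ¬ Tendsto (fun k => (nS (n k) : ℝ) / (n k 0 : ℝ)) atTop atTop) :
    -- the lower bound over `Θ(h)`
    Tendsto (fun a => liminf (fun k => minimaxProb H μ v r h (Set.Ioi 0) (n k) a) atTop)
      (𝓝[>] 0) (𝓝 1) ∧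
    -- if `n₀ / n_S` is bounded away from `0`, even with the value of `‖β_S‖_K` prescribed
    (((fun k => (nS (n k) : ℝ)) =O[atTop] fun k => (n k 0 : ℝ)) → ∀ R : ℝ, 0 < R →
      Tendsto (fun a => liminf (fun k => minimaxProb H μ v r h {R} (n k) a) atTop)
        (𝓝[>] 0) (𝓝 1)) := by
  constructor
  -- The norm of the common slope is free here, so it is taken large enough to absorb ξ and at least
  -- 1 to stay away from 0.
  · have hR : ∀ k, 1 ≤ max 1 (h * (((nS (n k) + n k 0 : ℕ) : ℝ) / n k 0) ^ r) :=
      fun k => le_max_left _ _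
    refine tendsto_liminf_minimaxProb hμ hv hs hr hdecay hT hh hn0
      (fun k => one_pos.trans_le (hR k)) one_pos hR (C₁ := 2) ?_
    filter_upwards [hn0.eventually_gt_atTop 0] with k hk
    exact rate_le_of_large_radius hr hh hk (one_pos.trans_le (hR k)) (le_max_right _ _)
  · intro hO R hR
    obtain ⟨c, hc, hcO⟩ := hO.exists_pos
    refine tendsto_liminf_minimaxProb hμ hv hs hr hdecay hT hh hn0 (R := fun _ => R)
      (fun k => rfl) hR (fun _ => le_rfl)
      (C₁ := 1 + (c + 1)⁻¹ ^ (-(2 * r) / (2 * r + 1)) * (h / R) ^ (2 / (2 * r + 1))) ?_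
    filter_upwards [hn0.eventually_gt_atTop 0, hcO.bound] with k hk hk2
    exact rate_le_of_comparable hr hh hk hR hc (by simpa using hk2)
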